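/- For a vertex $v$ of a finite simple graph $G$ and $k\ge 0$, let $w_G^k(v)$ be the number of walks of length $k$ in $G$ starting at $v$, and let $r_G^k(v)$ be the number of closed walks of length $k$ starting and ending at $v$. Vertices $v$ of $G$ and $u$ of $H$ (possibly $G=H$) are \emph{strongly walk-equivalent} if $w_G^k(v)=w_H^k(u)$ and $r_G^k(v)=r_H^k(u)$ for all $k$. Two vertices $x,y$ of $G$ are \emph{similar} if some automorphism of $G$ takes $x$ to $y$. A vertex $v$ of a connected graph $G$ on $n$ vertices is \emph{ambivalent} if there are a connected graph $H$ on $n$ vertices that is not isomorphic to $G$ and a vertex $u$ of $H$ such that $v$ and $u$ are strongly walk-equivalent. \emph{Almost every tree} has a property $P$ if the fraction of those labeled trees on $n$ vertices that have property $P$, among all labeled trees on $n$ vertices, tends to $1$ as $n\to\infty$. (1) Almost every tree has an ambivalent vertex. In fact, almost every tree has a vertex that is strongly walk-equivalent to a vertex of a non-isomorphic tree with the same number of vertices. (2) Almost every tree contains two non-similar strongly walk-equivalent vertices. -/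

import Mathlib

open Filter Topology

namespace TreeWalk

/-- The number of walks of length `k` in `G` that start at `v` (and end anywhere). -/
noncomputable def walkCount {V : Type*} (G : SimpleGraph V) (v : V) (k : ℕ) : ℕ :=
  Nat.card {p : Σ u : V, G.Walk v u // p.2.length = k}

/-- The number of closed walks of length `k` in `G` that start and end at `v`. -/
noncomputable def closedWalkCount {V : Type*} (G : SimpleGraph V) (v : V) (k : ℕ) : ℕ :=
  Nat.card {p : G.Walk v v // p.length = k}

/-- The vertices `v` of `G` and `u` of `H` have the same walk counts for every length. -/
def WalkEquivalent {V U : Type*} (G : SimpleGraph V) (v : V) (H : SimpleGraph U) (u : U) : Prop :=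
  ∀ k : ℕ, walkCount G v k = walkCount H u k

/-- The vertices `v` of `G` and `u` of `H` have the same closed walk counts for every length. -/
def ClosedWalkEquivalent {V U : Type*} (G : SimpleGraph V) (v : V)
    (H : SimpleGraph U) (u : U) : Prop :=
  ∀ k : ℕ, closedWalkCount G v k = closedWalkCount H u k

/-- `v` and `u` are both walk-equivalent and closed-walk-equivalent. -/
def StronglyWalkEquivalent {V U : Type*} (G : SimpleGraph V) (v : V)
    (H : SimpleGraph U) (u : U) : Prop :=
  WalkEquivalent G v H u ∧ ClosedWalkEquivalent G v H u

/-- Two vertices of `G` are similar if some automorphism of `G` takes one to the other. -/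
def Similar {V : Type*} (G : SimpleGraph V) (x y : V) : Prop :=
  ∃ α : G ≃g G, α x = y

/-- A vertex `v` of the (connected) `n`-vertex graph `G` is ambivalent if there is a connected
`n`-vertex graph `H`, not isomorphic to `G`, with a vertex `u` whose walk counts and closed walk
counts are those of `v`. Up to isomorphism, every `n`-vertex graph has vertex set `Fin n`. -/
def IsAmbivalent {n : ℕ} (G : SimpleGraph (Fin n)) (v : Fin n) : Prop :=
  ∃ H : SimpleGraph (Fin n), H.Connected ∧ IsEmpty (G ≃g H) ∧
    ∃ u : Fin n, StronglyWalkEquivalent G v H u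

/-- As `IsAmbivalent`, but the other graph has to be a tree. -/
def IsTreeAmbivalent {n : ℕ} (G : SimpleGraph (Fin n)) (v : Fin n) : Prop :=
  ∃ H : SimpleGraph (Fin n), H.IsTree ∧ IsEmpty (G ≃g H) ∧
    ∃ u : Fin n, StronglyWalkEquivalent G v H u

/-- Among the labeled trees on `n` vertices, the fraction of those that have the property `P`
tends to `1` as `n` tends to infinity. -/
def AlmostEveryTree (P : ∀ n : ℕ, SimpleGraph (Fin n) → Prop) : Prop :=
  Tendsto
    (fun n : ℕ =>
      (Nat.card {T : SimpleGraph (Fin n) // T.IsTree ∧ P n T} : ℝ) /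
        (Nat.card {T : SimpleGraph (Fin n) // T.IsTree} : ℝ))
    atTop (𝓝 1)

end TreeWalk

/-! The 11-vertex tree `limb` has a hidden linear symmetry that is not an automorphism:
`limbInvolution` divided by 7 is a rational orthogonal involution that commutes with adjacency,
fixes the all-ones vector and exchanges the indicators of the vertices 6 and 2. Walk counts
therefore cannot tell whether a copy of `limb` hangs by 6 or by 2, whereas vertex degrees can.

Hang two copies on a vertex c of any graph R, one by 6 and one by 2. Applying the involution to both
copies while exchanging them gives a symmetry of the whole adjacency matrix that carries the 6 next
to c to the 2 next to c; these are the non-similar equivalent vertices. Applying it to the first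
copy alone intertwines the graph with the one in which both copies hang by 2, and c itself is fixed;
so c is ambivalent. Both facts are instances of `stronglyWalkEquivalent_of_intertwining`. Counting
vertices of degree 2 with a prescribed sum of neighbor degrees yields the non-isomorphism and the
non-similarity.

It remains to see that almost every tree contains this pair of limbs as a pendant subtree, which is
a second moment argument. With a fixed root r, labeled trees are parent functions, counted by
Cayley's formula for forests (`card_forests`). Let X be the number of placements of the pendant
subtree. Overlapping placements have the same vertex set and contribute only a lower-order term to
the sum of X²; disjoint pairs contribute asymptotically at most the square of the mean. By
Cauchy–Schwarz the fraction of trees with X > 0 is at least `fractionBound`, which tends to 1. -/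

namespace TreeWalk

/-! ### Walk counts and intertwining matrices -/

section Intertwining

variable {V U : Type*} [Fintype V] [DecidableEq V] [Fintype U] [DecidableEq U]

lemma closedWalkCount_eq_adjMatrix_pow (G : SimpleGraph V) [DecidableRel G.Adj] (v : V) (k : ℕ) :
    (closedWalkCount G v k : ℤ) = (G.adjMatrix ℤ ^ k) v v := by
  rw [SimpleGraph.adjMatrix_pow_apply_eq_card_walk, closedWalkCount, ← Nat.card_eq_fintype_card]
  rfl

lemma walkCount_eq_adjMatrix_pow (G : SimpleGraph V) [DecidableRel G.Adj] (v : V) (k : ℕ) :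
    (walkCount G v k : ℤ) = ((G.adjMatrix ℤ ^ k).mulVec 1) v := by
  have e : {p : Σ u : V, G.Walk v u // p.2.length = k} ≃
      Σ u : V, {p : G.Walk v u // p.length = k} :=
    { toFun := fun p => ⟨p.1.1, p.1.2, p.2⟩
      invFun := fun p => ⟨⟨p.1, p.2.1⟩, p.2.2⟩
      left_inv := fun _ => rfl
      right_inv := fun _ => rfl }
  have fin (u : V) : Fintype {p : G.Walk v u // p.length = k} :=
    inferInstanceAs (Fintype {p : G.Walk v u | p.length = k})
  rw [walkCount, Nat.card_congr e, Nat.card_sigma]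
  simp only [Matrix.mulVec, dotProduct, Pi.one_apply, mul_one, Nat.cast_sum]
  refine Finset.sum_congr rfl fun u _ => ?_
  rw [SimpleGraph.adjMatrix_pow_apply_eq_card_walk, ← Nat.card_eq_fintype_card]
  rfl

/-- A scaled isometry that intertwines two adjacency matrices, fixes the all-ones vector and maps
the indicator of `v` to that of `u` makes `v` and `u` strongly walk-equivalent. -/
theorem stronglyWalkEquivalent_of_intertwining (G : SimpleGraph V) (H : SimpleGraph U)
    [DecidableRel G.Adj] [DecidableRel H.Adj] (v : V) (u : U) (s : ℤ) (hs : s ≠ 0)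
    (Q : Matrix U V ℤ) (hQ : Q.transpose * Q = (s ^ 2) • (1 : Matrix V V ℤ))
    (hA : H.adjMatrix ℤ * Q = Q * G.adjMatrix ℤ)
    (h1 : Q.mulVec 1 = s • (1 : U → ℤ)) (hv : ∀ a, Q a v = if a = u then s else 0) :
    StronglyWalkEquivalent G v H u := by
  have hpow (k : ℕ) : H.adjMatrix ℤ ^ k * Q = Q * G.adjMatrix ℤ ^ k := by
    induction k with
    | zero => simp
    | succ k ih => rw [pow_succ, Matrix.mul_assoc, hA, ← Matrix.mul_assoc, ih, Matrix.mul_assoc,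
        ← pow_succ]
  -- Applied to the all-ones vector and read at `v`, this compares walk counts; its (v, v) entry
  -- compares closed walk counts.
  have hmain (k : ℕ) : Q.transpose * (H.adjMatrix ℤ ^ k * Q) = (s ^ 2) • G.adjMatrix ℤ ^ k := by
    rw [hpow, ← Matrix.mul_assoc, hQ, Matrix.smul_mul, Matrix.one_mul]
  have hs2 : s ^ 2 ≠ 0 := pow_ne_zero 2 hs
  constructor
  · intro k
    have h2 : Q.transpose.mulVec ((H.adjMatrix ℤ ^ k).mulVec (Q.mulVec 1)) =
        (s ^ 2) • (G.adjMatrix ℤ ^ k).mulVec 1 := by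
      rw [Matrix.mulVec_mulVec, Matrix.mulVec_mulVec, Matrix.mul_assoc, hmain, Matrix.smul_mulVec]
    rw [h1, Matrix.mulVec_smul, Matrix.mulVec_smul] at h2
    have h3 := congrFun h2 v
    simp only [Pi.smul_apply, Matrix.mulVec, dotProduct, Matrix.transpose_apply, hv, ite_mul,
      zero_mul, Finset.sum_ite_eq', Finset.mem_univ, if_true, smul_eq_mul] at h3
    have h4 : s ^ 2 * (walkCount G v k : ℤ) = s ^ 2 * (walkCount H u k : ℤ) := by
      rw [walkCount_eq_adjMatrix_pow, walkCount_eq_adjMatrix_pow]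
      simp only [Matrix.mulVec, dotProduct]
      rw [← h3]; ring
    exact_mod_cast mul_left_cancel₀ hs2 h4
  · intro k
    have h3 := congrFun (congrFun (hmain k) v) v
    simp only [Matrix.smul_apply, Matrix.mul_apply, Matrix.transpose_apply, hv, ite_mul, mul_ite,
      mul_zero, zero_mul, Finset.sum_ite_eq', Finset.mem_univ, if_true,
      smul_eq_mul] at h3
    have h4 : s ^ 2 * (closedWalkCount G v k : ℤ) = s ^ 2 * (closedWalkCount H u k : ℤ) := by
      rw [closedWalkCount_eq_adjMatrix_pow, closedWalkCount_eq_adjMatrix_pow, ← h3]; ring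
    exact_mod_cast mul_left_cancel₀ hs2 h4

end Intertwining

/-! ### Two copies of a graph attached to a vertex -/

section Dock

variable {W X Λ : Type*}

/-- Two copies of `L` attached to the vertex `c` of `R`, the first one by an edge from `c` to `a`,
the second one by an edge from `c` to `b`. -/
def dock (R : SimpleGraph W) (c : W) (L : SimpleGraph Λ) (a b : Λ) :
    SimpleGraph (W ⊕ (Λ ⊕ Λ)) where
  Adj
    | .inl u, .inl v => R.Adj u v
    | .inl u, .inr (.inl i) => u = c ∧ i = a
    | .inl u, .inr (.inr i) => u = c ∧ i = b
    | .inr (.inl i), .inl u => u = c ∧ i = a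
    | .inr (.inr i), .inl u => u = c ∧ i = b
    | .inr (.inl i), .inr (.inl j) => L.Adj i j
    | .inr (.inr i), .inr (.inr j) => L.Adj i j
    | .inr (.inl _), .inr (.inr _) => False
    | .inr (.inr _), .inr (.inl _) => False
  symm := ⟨by
    rintro (u | i | i) (v | j | j) h
    all_goals first | exact h | exact h.symm⟩
  loopless := ⟨by
    rintro (u | i | i) h
    all_goals exact SimpleGraph.irrefl _ h⟩

variable [Fintype W] [DecidableEq W] [Fintype X] [DecidableEq X] [Fintype Λ] [DecidableEq Λ]

section Block

variable (G H : SimpleGraph (W ⊕ X)) [DecidableRel G.Adj] [DecidableRel H.Adj]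
  {A : Matrix W W ℤ} {B B' : Matrix W X ℤ} {M D : Matrix X X ℤ} {s : ℤ}

/-- A symmetry `D` of the attached part `M` extends by the scalar `s` on the common part `W`. The
only compatibility needed is that `D` transforms one set of connecting edges into the other. -/
theorem stronglyWalkEquivalent_of_fromBlocks (hs : s ≠ 0)
    (hG : G.adjMatrix ℤ = Matrix.fromBlocks A B B.transpose M)
    (hH : H.adjMatrix ℤ = Matrix.fromBlocks A B' B'.transpose M)
    (hD : D.transpose = D) (hDD : D * D = (s ^ 2) • (1 : Matrix X X ℤ)) (hM : M * D = D * M)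
    (hB : B' * D = s • B) (h1 : D.mulVec 1 = s • (1 : X → ℤ)) :
    (∀ w, StronglyWalkEquivalent G (.inl w) H (.inl w)) ∧
    ∀ x y, (∀ z, D z x = if z = y then s else 0) →
      StronglyWalkEquivalent G (.inr x) H (.inr y) := by
  -- Transposing `hB` and multiplying by `D` leaves a surplus factor `s`, which cancels because `s ≠
  -- 0`.
  have hB' : D * B.transpose = s • B'.transpose := by
    have h := congrArg (fun N => D * Matrix.transpose N) hB
    simp only [Matrix.transpose_mul, hD, Matrix.transpose_smul, Matrix.mul_smul] at h
    rw [← Matrix.mul_assoc, hDD, Matrix.smul_mul, Matrix.one_mul, pow_two, mul_smul] at h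
    exact (smul_right_injective _ hs h).symm
  set Q : Matrix (W ⊕ X) (W ⊕ X) ℤ := Matrix.fromBlocks (s • 1) 0 0 D with hQ
  have hQQ : Q.transpose * Q = (s ^ 2) • (1 : Matrix (W ⊕ X) (W ⊕ X) ℤ) := by
    rw [hQ, Matrix.fromBlocks_transpose, Matrix.fromBlocks_multiply, ← Matrix.fromBlocks_one,
      Matrix.fromBlocks_smul]
    simp [hD, hDD, pow_two]
  have hA : H.adjMatrix ℤ * Q = Q * G.adjMatrix ℤ := by
    rw [hQ, hG, hH, Matrix.fromBlocks_multiply, Matrix.fromBlocks_multiply]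
    simp [hM, hB, hB', -zsmul_eq_mul, -zsmul_one]
  have hQ1 : Q.mulVec 1 = s • (1 : W ⊕ X → ℤ) := by
    rw [hQ, Matrix.fromBlocks_mulVec]
    ext (w | x)
    · simp [Function.comp_def]
    · simpa [Function.comp_def, Matrix.mulVec, dotProduct] using congrFun h1 x
  refine ⟨fun w => ?_, fun x y hxy => ?_⟩
  · refine stronglyWalkEquivalent_of_intertwining G H _ _ s hs Q hQQ hA hQ1 ?_
    rintro (w' | x)
    · simp [hQ, Matrix.one_apply, -zsmul_eq_mul, -zsmul_one]
    · simp [hQ]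
  · refine stronglyWalkEquivalent_of_intertwining G H _ _ s hs Q hQQ hA hQ1 ?_
    rintro (w' | z)
    · simp [hQ]
    · simp [hQ, hxy]

end Block

/-- The incidences between `c` and the two copies attached to it. -/
def dockIncidence (c : W) (a b : Λ) : Matrix W (Λ ⊕ Λ) ℤ :=
  Matrix.of fun w => Sum.elim (fun i => if w = c ∧ i = a then 1 else 0)
    (fun i => if w = c ∧ i = b then 1 else 0)

omit [Fintype W] [Fintype Λ] in
lemma adjMatrix_dock (R : SimpleGraph W) (c : W) (L : SimpleGraph Λ) (a b : Λ)
    [DecidableRel R.Adj] [DecidableRel L.Adj] [DecidableRel (dock R c L a b).Adj] :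
    (dock R c L a b).adjMatrix ℤ = Matrix.fromBlocks (R.adjMatrix ℤ) (dockIncidence c a b)
      (dockIncidence c a b).transpose
      (Matrix.fromBlocks (L.adjMatrix ℤ) 0 0 (L.adjMatrix ℤ)) := by
  ext (u | i | i) (v | j | j) <;> rw [SimpleGraph.adjMatrix_apply] <;>
    simp [dock, dockIncidence] <;> congr

/-- The symmetry applies `K` and exchanges the two copies. Since `K` also exchanges `a` and `b`,
each attaching edge lands on the other one. -/
theorem stronglyWalkEquivalent_dock_swap (R : SimpleGraph W) (c : W) (L : SimpleGraph Λ)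
    [DecidableRel L.Adj] {a b : Λ} {K : Matrix Λ Λ ℤ} {s : ℤ} (hs : s ≠ 0) (hK : K.transpose = K)
    (hKK : K * K = (s ^ 2) • (1 : Matrix Λ Λ ℤ)) (hL : L.adjMatrix ℤ * K = K * L.adjMatrix ℤ)
    (h1 : K.mulVec 1 = s • (1 : Λ → ℤ)) (hab : ∀ i, K i a = if i = b then s else 0)
    (hba : ∀ i, K i b = if i = a then s else 0) :
    StronglyWalkEquivalent (dock R c L a b) (.inr (.inl a)) (dock R c L a b) (.inr (.inr b)) := by
  classical
  refine (stronglyWalkEquivalent_of_fromBlocks (dock R c L a b) (dock R c L a b)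
    (D := Matrix.fromBlocks 0 K K 0) hs (adjMatrix_dock R c L a b) (adjMatrix_dock R c L a b)
    ?_ ?_ ?_ ?_ ?_).2 _ _ ?_
  · simp [Matrix.fromBlocks_transpose, hK]
  · simp [Matrix.fromBlocks_multiply, hKK, ← Matrix.fromBlocks_one, Matrix.fromBlocks_smul]
  · simp [Matrix.fromBlocks_multiply, hL]
  · have hab' (i) : K b i = if i = a then s else 0 := by rw [← hba, ← Matrix.transpose_apply K, hK]
    have hba' (i) : K a i = if i = b then s else 0 := by rw [← hab, ← Matrix.transpose_apply K, hK]
    ext w (i | i) <;> by_cases hw : w = c <;>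
      simp [Matrix.mul_apply, dockIncidence, hw, hab', hba']
  · ext (i | i) <;> simpa [Matrix.fromBlocks_mulVec, Function.comp_def, Matrix.mulVec, dotProduct] using congrFun h1 i
  · rintro (i | i) <;> simp [hab]

/-- Here `K` acts on the first copy only, and everything else is scaled by `s`. This moves the first
attaching edge from `a` to `b`. -/
theorem stronglyWalkEquivalent_dock_dock (R : SimpleGraph W) (c : W) (L : SimpleGraph Λ)
    [DecidableRel L.Adj] {a b : Λ} {K : Matrix Λ Λ ℤ} {s : ℤ} (hs : s ≠ 0) (hK : K.transpose = K)
    (hKK : K * K = (s ^ 2) • (1 : Matrix Λ Λ ℤ)) (hL : L.adjMatrix ℤ * K = K * L.adjMatrix ℤ)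
    (h1 : K.mulVec 1 = s • (1 : Λ → ℤ)) (hba : ∀ i, K i b = if i = a then s else 0) (d : Λ) :
    StronglyWalkEquivalent (dock R c L a d) (.inl c) (dock R c L b d) (.inl c) := by
  classical
  refine (stronglyWalkEquivalent_of_fromBlocks (dock R c L a d) (dock R c L b d)
    (D := Matrix.fromBlocks K 0 0 (s • 1)) hs (adjMatrix_dock R c L a d)
    (adjMatrix_dock R c L b d) ?_ ?_ ?_ ?_ ?_).1 _
  · simp [Matrix.fromBlocks_transpose, hK]
  · simp [Matrix.fromBlocks_multiply, hKK, ← Matrix.fromBlocks_one, Matrix.fromBlocks_smul, pow_two]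
  · simp [Matrix.fromBlocks_multiply, hL, -zsmul_eq_mul, -zsmul_one]
  · have hab' (i) : K b i = if i = a then s else 0 := by rw [← hba, ← Matrix.transpose_apply K, hK]
    ext w (i | i) <;> by_cases hw : w = c <;>
      simp [Matrix.mul_apply, dockIncidence, hw, hab', Matrix.one_apply, -zsmul_eq_mul,
        -zsmul_one]
  · ext (i | i)
    · simpa [Matrix.fromBlocks_mulVec, Function.comp_def, Matrix.mulVec, dotProduct] using congrFun h1 i
    · simp [Matrix.fromBlocks_mulVec, Function.comp_def]

end Dock

/-! ### The limb and its hidden symmetry -/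

section Limb

/-- The tree used as a limb, as the parent function of its rooting at the vertex `6`. -/
def limbParentSix : Fin 11 → Fin 11 := ![6, 0, 1, 2, 3, 3, 6, 6, 7, 8, 0]

/-- The parent function of the rooting of the same tree at the vertex `2`. -/
def limbParentTwo : Fin 11 → Fin 11 := ![1, 2, 2, 2, 3, 3, 0, 6, 7, 8, 0]

/-- A tree with two non-similar strongly walk-equivalent vertices, `6` and `2`. -/
def limb : SimpleGraph (Fin 11) := SimpleGraph.fromRel fun i j => limbParentSix i = j

instance : DecidableRel limb.Adj := fun i j =>
  decidable_of_iff (i ≠ j ∧ (limbParentSix i = j ∨ limbParentSix j = i)) Iff.rfl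

lemma limb_adj_iff_limbParentSix (i j : Fin 11) :
    limb.Adj i j ↔ i ≠ j ∧ (limbParentSix i = j ∨ limbParentSix j = i) := Iff.rfl

/-- Both rootings describe one graph, so a copy hanging by 2 in a rooted tree is still a copy of
`limb`. -/
lemma limb_adj_iff_limbParentTwo (i j : Fin 11) :
    limb.Adj i j ↔ i ≠ j ∧ (limbParentTwo i = j ∨ limbParentTwo j = i) := by
  revert i j; decide

/-- Seven times a rational orthogonal involution that commutes with the adjacency matrix of `limb`,
fixes the all-ones vector and swaps the indicators of `6` and `2`. -/
def limbInvolution : Matrix (Fin 11) (Fin 11) ℤ :=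
  !![
    2, 3, 0, 4, -1, -1, 0, -2, 1, -2, 3;
    3, 1, 0, -1, 2, 2, 0, 4, -2, -3, 1;
    0, 0, 0, 0, 0, 0, 7, 0, 0, 0, 0;
    4, -1, 0, 1, -2, -2, 0, 3, 2, 3, -1;
    -1, 2, 0, -2, 4, -3, 0, 1, 3, 1, 2;
    -1, 2, 0, -2, -3, 4, 0, 1, 3, 1, 2;
    0, 0, 7, 0, 0, 0, 0, 0, 0, 0, 0;
    -2, 4, 0, 3, 1, 1, 0, 2, -1, 2, -3;
    1, -2, 0, 2, 3, 3, 0, -1, 4, -1, -2;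
    -2, -3, 0, 3, 1, 1, 0, 2, -1, 2, 4;
    3, 1, 0, -1, 2, 2, 0, -3, -2, 4, 1]

lemma limbInvolution_transpose : limbInvolution.transpose = limbInvolution := by
  ext i j
  have h : ∀ i j : Fin 11, limbInvolution j i - limbInvolution i j = 0 := by decide +kernel
  exact sub_eq_zero.1 (h i j)

lemma limbInvolution_mul_self : limbInvolution * limbInvolution = ((7 : ℤ) ^ 2) • 1 := by
  ext i j; revert i j; decide +kernel

lemma limb_adjMatrix_mul_limbInvolution :
    limb.adjMatrix ℤ * limbInvolution = limbInvolution * limb.adjMatrix ℤ := by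
  ext i j
  revert i j; decide +kernel

lemma limbInvolution_mulVec_one : limbInvolution.mulVec 1 = (7 : ℤ) • 1 := by
  ext i; revert i; decide +kernel

lemma limbInvolution_apply_six (i : Fin 11) : limbInvolution i 6 = if i = 2 then 7 else 0 := by
  revert i; decide +kernel

lemma limbInvolution_apply_two (i : Fin 11) : limbInvolution i 2 = if i = 6 then 7 else 0 := by
  revert i; decide +kernel

theorem stronglyWalkEquivalent_dock_limb_copies {W : Type*} [Fintype W] [DecidableEq W]
    (R : SimpleGraph W) (c : W) :
    StronglyWalkEquivalent (dock R c limb 6 2) (.inr (.inl 6)) (dock R c limb 6 2)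
      (.inr (.inr 2)) :=
  stronglyWalkEquivalent_dock_swap R c limb (by norm_num) limbInvolution_transpose
    limbInvolution_mul_self limb_adjMatrix_mul_limbInvolution limbInvolution_mulVec_one
    limbInvolution_apply_six limbInvolution_apply_two

theorem stronglyWalkEquivalent_dock_limb {W : Type*} [Fintype W] [DecidableEq W]
    (R : SimpleGraph W) (c : W) :
    StronglyWalkEquivalent (dock R c limb 6 2) (.inl c) (dock R c limb 2 2) (.inl c) :=
  stronglyWalkEquivalent_dock_dock R c limb (by norm_num) limbInvolution_transpose
    limbInvolution_mul_self limb_adjMatrix_mul_limbInvolution limbInvolution_mulVec_one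
    limbInvolution_apply_two 2

end Limb

/-! ### Degree invariants of docked graphs -/

section NeighborSums

variable {V U W Λ : Type*} [Fintype V] [Fintype U] [Fintype W] [Fintype Λ]

/-- The sum of `u` over the neighbors of `v`. -/
def nbrSum (G : SimpleGraph V) [DecidableRel G.Adj] (u : V → ℕ) (v : V) : ℕ :=
  ∑ w, if G.Adj v w then u w else 0

/-- Starting from the constant 1, iterating `nbrSum` produces degrees, sums of neighbor degrees, and
so on, all invariant under isomorphism. -/
lemma nbrSum_iso {G : SimpleGraph V} {H : SimpleGraph U} [DecidableRel G.Adj] [DecidableRel H.Adj]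
    (e : G ≃g H) (u : U → ℕ) (v : V) : nbrSum H u (e v) = nbrSum G (u ∘ e) v := by
  unfold nbrSum
  rw [← e.toEquiv.sum_comp]
  refine Finset.sum_congr rfl fun w _ => ?_
  simp [e.map_adj_iff]

/-- The indicator of the vertices of degree `2` whose neighbors have degrees adding up to `k`. -/
def twoPattern (G : SimpleGraph V) [DecidableRel G.Adj] (k : ℕ) (v : V) : ℕ :=
  if nbrSum G 1 v = 2 ∧ nbrSum G (nbrSum G 1) v = k then 1 else 0

lemma twoPattern_iso {G : SimpleGraph V} {H : SimpleGraph U} [DecidableRel G.Adj]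
    [DecidableRel H.Adj] (e : G ≃g H) (k : ℕ) (v : V) :
    twoPattern H k (e v) = twoPattern G k v := by
  have h1 : nbrSum H 1 ∘ e = nbrSum G 1 := funext fun w => nbrSum_iso e 1 w
  have h2 : nbrSum H 1 (e v) = nbrSum G 1 v := congrFun h1 v
  rw [twoPattern, twoPattern, h2, nbrSum_iso e (nbrSum H 1), h1]

variable [DecidableEq W] [DecidableEq Λ] (R : SimpleGraph W) (c : W) (L : SimpleGraph Λ) (a b : Λ)
  [DecidableRel R.Adj] [DecidableRel L.Adj] [DecidableRel (dock R c L a b).Adj]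
  (u : W ⊕ (Λ ⊕ Λ) → ℕ)

omit [DecidableRel L.Adj] in
lemma nbrSum_dock_inl (w : W) : nbrSum (dock R c L a b) u (.inl w) =
    nbrSum R (u ∘ .inl) w + if w = c then u (.inr (.inl a)) + u (.inr (.inr b)) else 0 := by
  by_cases h : w = c <;> simp [nbrSum, dock, h]
  exact Finset.sum_congr rfl fun _ _ => by congr

omit [DecidableRel R.Adj] in
lemma nbrSum_dock_inr_inl (i : Λ) : nbrSum (dock R c L a b) u (.inr (.inl i)) =
    nbrSum L (u ∘ .inr ∘ .inl) i + if i = a then u (.inl c) else 0 := by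
  by_cases h : i = a <;> simp [nbrSum, dock, h, add_comm]
  exact Finset.sum_congr rfl fun _ _ => by congr

omit [DecidableRel R.Adj] in
lemma nbrSum_dock_inr_inr (i : Λ) : nbrSum (dock R c L a b) u (.inr (.inr i)) =
    nbrSum L (u ∘ .inr ∘ .inr) i + if i = b then u (.inl c) else 0 := by
  by_cases h : i = b <;> simp [nbrSum, dock, h, add_comm]
  exact Finset.sum_congr rfl fun _ _ => by congr

omit [DecidableRel L.Adj] in
lemma nbrSum_one_dock_inl (w : W) : nbrSum (dock R c L a b) 1 (.inl w) =
    nbrSum R 1 w + if w = c then 2 else 0 :=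
  nbrSum_dock_inl R c L a b 1 w

omit [DecidableRel R.Adj] in
lemma nbrSum_one_dock_inr_inl (i : Λ) : nbrSum (dock R c L a b) 1 (.inr (.inl i)) =
    nbrSum L 1 i + if i = a then 1 else 0 :=
  nbrSum_dock_inr_inl R c L a b 1 i

omit [DecidableRel R.Adj] in
lemma nbrSum_one_dock_inr_inr (i : Λ) : nbrSum (dock R c L a b) 1 (.inr (.inr i)) =
    nbrSum L 1 i + if i = b then 1 else 0 :=
  nbrSum_dock_inr_inr R c L a b 1 i

lemma nbrSum_nbrSum_one_dock_inr_inl (i : Λ) :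
    nbrSum (dock R c L a b) (nbrSum (dock R c L a b) 1) (.inr (.inl i)) =
    nbrSum L (fun j => nbrSum L 1 j + if j = a then 1 else 0) i +
      if i = a then nbrSum R 1 c + 2 else 0 := by
  rw [nbrSum_dock_inr_inl, nbrSum_one_dock_inl, if_pos rfl]
  congr 2
  exact funext fun j => nbrSum_one_dock_inr_inl R c L a b j

lemma nbrSum_nbrSum_one_dock_inr_inr (i : Λ) :
    nbrSum (dock R c L a b) (nbrSum (dock R c L a b) 1) (.inr (.inr i)) =
    nbrSum L (fun j => nbrSum L 1 j + if j = b then 1 else 0) i +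
      if i = b then nbrSum R 1 c + 2 else 0 := by
  rw [nbrSum_dock_inr_inr, nbrSum_one_dock_inl, if_pos rfl]
  congr 2
  exact funext fun j => nbrSum_one_dock_inr_inr R c L a b j

lemma nbrSum_nbrSum_one_dock_inl (w : W) :
    nbrSum (dock R c L a b) (nbrSum (dock R c L a b) 1) (.inl w) =
    nbrSum R (fun x => nbrSum R 1 x + if x = c then 2 else 0) w +
      if w = c then (nbrSum L 1 a + 1) + (nbrSum L 1 b + 1) else 0 := by
  rw [nbrSum_dock_inl, nbrSum_one_dock_inr_inl, nbrSum_one_dock_inr_inr, if_pos rfl, if_pos rfl]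
  congr 2
  exact funext fun x => nbrSum_one_dock_inl R c L a b x

end NeighborSums

/-! ### Non-isomorphism and non-similarity -/

section LimbInvariants

variable {W : Type*} [Fintype W] [DecidableEq W] (R : SimpleGraph W) (c : W)

/-- The number of vertices of degree 2 with neighbor degrees summing to 4 differs. The contributions
of `R` and of the second copy agree; the first copy contributes nothing when it hangs by 6, but at
least vertex 7 when it hangs by 2. -/
theorem isEmpty_dock_limb_iso : IsEmpty (dock R c limb 6 2 ≃g dock R c limb 2 2) := by
  classical
  refine ⟨fun e => ?_⟩
  have h : ∑ v, twoPattern (dock R c limb 2 2) 4 v = ∑ v, twoPattern (dock R c limb 6 2) 4 v := by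
    rw [← e.toEquiv.sum_comp]
    exact Finset.sum_congr rfl fun v _ => twoPattern_iso e 4 v
  have hinl (w : W) : twoPattern (dock R c limb 2 2) 4 (.inl w) =
      twoPattern (dock R c limb 6 2) 4 (.inl w) := by
    -- From `R` one sees at most the degree of the attached vertex, and 6 and 2 have the same
    -- degree.
    have h62 : nbrSum limb 1 6 = nbrSum limb 1 2 := by decide +kernel
    simp only [twoPattern, nbrSum_one_dock_inl, nbrSum_nbrSum_one_dock_inl, h62]
  have hinr (i : Fin 11) : twoPattern (dock R c limb 2 2) 4 (.inr (.inr i)) =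
      twoPattern (dock R c limb 6 2) 4 (.inr (.inr i)) := by
    simp only [twoPattern, nbrSum_one_dock_inr_inr, nbrSum_nbrSum_one_dock_inr_inr]
  have h6 (i : Fin 11) : twoPattern (dock R c limb 6 2) 4 (.inr (.inl i)) = 0 := by
    rw [twoPattern, nbrSum_one_dock_inr_inl, nbrSum_nbrSum_one_dock_inr_inl]
    -- Once attached, 6 has degree 3 and is never counted. This excludes the only vertex of the copy
    -- whose neighbor sum involves the unknown degree of `c`; the rest is a finite check.
    by_cases hi : i = 6
    · subst hi
      rw [if_neg fun h => absurd h.1 (by decide +kernel)]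
    · simp only [if_neg hi, add_zero]
      revert i; decide +kernel
  have h2 : twoPattern (dock R c limb 2 2) 4 (.inr (.inl 7)) = 1 := by
    rw [twoPattern, nbrSum_one_dock_inr_inl, nbrSum_nbrSum_one_dock_inr_inl]
    rw [if_neg (by decide : ¬ (7 : Fin 11) = 2), if_neg (by decide : ¬ (7 : Fin 11) = 2)]
    decide +kernel
  have h2' : 1 ≤ ∑ i, twoPattern (dock R c limb 2 2) 4 (.inr (.inl i)) := by
    rw [← h2]
    exact Finset.single_le_sum (f := fun i => twoPattern (dock R c limb 2 2) 4 (.inr (.inl i)))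
      (fun _ _ => Nat.zero_le _) (Finset.mem_univ 7)
  simp only [Fintype.sum_sum_type, hinl, hinr, h6, Finset.sum_const_zero] at h
  omega

/-- Count the neighbors of degree 2 whose own neighbor degrees sum to 5. Within its copy the
attached 6 has one such neighbor, namely 7, and the attached 2 has none. The shared neighbor `c`
contributes equally to both and cancels. -/
theorem not_similar_dock_limb :
    ¬ Similar (dock R c limb 6 2) (.inr (.inl 6)) (.inr (.inr 2)) := by
  classical
  rintro ⟨e, he⟩
  have h := nbrSum_iso e (twoPattern (dock R c limb 6 2) 5) (.inr (.inl 6))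
  have h' : twoPattern (dock R c limb 6 2) 5 ∘ e = twoPattern (dock R c limb 6 2) 5 :=
    funext fun v => twoPattern_iso e 5 v
  rw [he, h', nbrSum_dock_inr_inr, nbrSum_dock_inr_inl, if_pos rfl, if_pos rfl] at h
  have h6 : twoPattern (dock R c limb 6 2) 5 ∘ .inr ∘ .inl = fun i => if i = 6 then 0 else
      if nbrSum limb 1 i = 2 ∧
        nbrSum limb (fun j => nbrSum limb 1 j + if j = 6 then 1 else 0) i = 5 then 1 else 0 := by
    funext i
    rw [Function.comp_apply, Function.comp_apply, twoPattern, nbrSum_one_dock_inr_inl,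
      nbrSum_nbrSum_one_dock_inr_inl]
    by_cases hi : i = 6
    · subst hi
      rw [if_neg fun h => absurd h.1 (by decide +kernel), if_pos rfl]
    · simp only [if_neg hi, add_zero]
  have h2 : twoPattern (dock R c limb 6 2) 5 ∘ .inr ∘ .inr = fun i => if i = 2 then 0 else
      if nbrSum limb 1 i = 2 ∧
        nbrSum limb (fun j => nbrSum limb 1 j + if j = 2 then 1 else 0) i = 5 then 1 else 0 := by
    funext i
    rw [Function.comp_apply, Function.comp_apply, twoPattern, nbrSum_one_dock_inr_inr,
      nbrSum_nbrSum_one_dock_inr_inr]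
    by_cases hi : i = 2
    · subst hi
      rw [if_neg fun h => absurd h.1 (by decide +kernel), if_pos rfl]
    · simp only [if_neg hi, add_zero]
  rw [h6, h2] at h
  exact absurd (add_right_cancel h) (by decide +kernel)

end LimbInvariants

/-! ### Rooted trees as parent functions -/

section ParentFunctions

variable {V : Type*}

/-- `f` is the parent function of a tree on `V` that is rooted at `r`. -/
def IsParent (r : V) (f : V → V) : Prop := f r = r ∧ ∀ v, ∃ k, f^[k] v = r

/-- The tree with parent function `f`. -/
def parentGraph (f : V → V) : SimpleGraph V := SimpleGraph.fromRel fun u v => f u = v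

lemma parentGraph_adj {f : V → V} {u v : V} :
    (parentGraph f).Adj u v ↔ u ≠ v ∧ (f u = v ∨ f v = u) := Iff.rfl

namespace IsParent

variable {r : V} {f g : V → V}

lemma apply_ne (hf : IsParent r f) {v : V} (hv : v ≠ r) : f v ≠ v := fun h => by
  obtain ⟨k, hk⟩ := hf.2 v
  rw [Function.iterate_fixed h] at hk
  exact hv hk

lemma apply_apply_ne (hf : IsParent r f) {v : V} (hv : v ≠ r) : f (f v) ≠ v := fun h => by
  have key (k : ℕ) : f^[k] v = v ∨ f^[k] v = f v := by
    induction k with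
    | zero => exact Or.inl rfl
    | succ k ih =>
      rw [Function.iterate_succ_apply']
      rcases ih with ih | ih <;> simp [ih, h]
  obtain ⟨k, hk⟩ := hf.2 v
  rcases key k with h' | h'
  · exact hv (h' ▸ hk)
  · rw [hk] at h'
    rw [← h', hf.1] at h
    exact hv h.symm

lemma adj (hf : IsParent r f) {v : V} (hv : v ≠ r) : (parentGraph f).Adj v (f v) :=
  parentGraph_adj.2 ⟨(hf.apply_ne hv).symm, Or.inl rfl⟩

lemma connected (hf : IsParent r f) : (parentGraph f).Connected := by
  have key (k : ℕ) (v : V) (h : f^[k] v = r) : (parentGraph f).Reachable v r := by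
    induction k generalizing v with
    | zero => exact h ▸ SimpleGraph.Reachable.refl _
    | succ k ih =>
      by_cases hv : v = r
      · exact hv ▸ SimpleGraph.Reachable.refl _
      · exact (hf.adj hv).reachable.trans (ih (f v) h)
  have := Nonempty.intro r
  refine SimpleGraph.Connected.mk fun u v => ?_
  obtain ⟨k, hk⟩ := hf.2 u
  obtain ⟨l, hl⟩ := hf.2 v
  exact (key k u hk).trans (key l v hl).symm

/-- Every edge joins a non-root vertex to its parent, so a connected graph on n vertices has at most
n - 1 edges here. -/
lemma isTree [Fintype V] (hf : IsParent r f) : (parentGraph f).IsTree := by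
  classical
  rw [SimpleGraph.isTree_iff_connected_and_card]
  refine ⟨hf.connected, le_antisymm ?_ hf.connected.card_vert_le_card_edgeSet_add_one⟩
  have hsub : (parentGraph f).edgeSet ⊆
      ((Finset.univ.erase r).image fun v => s(v, f v) : Finset (Sym2 V)) := by
    intro e
    induction e with
    | h u v =>
      intro h
      obtain ⟨hne, h⟩ := parentGraph_adj.1 h
      simp only [Finset.coe_image, Set.mem_image, Finset.mem_coe, Finset.mem_erase,
        Finset.mem_univ, and_true]
      rcases h with h | h
      · exact ⟨u, fun hu => hne (by rw [← h, hu, hf.1]), by rw [h]⟩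
      · exact ⟨v, fun hv => hne (by rw [← h, hv, hf.1]), by rw [h, Sym2.eq_swap]⟩
  have h1 := Nat.card_mono (Finset.finite_toSet _) hsub
  rw [Nat.card_coe_set_eq, Nat.card_coe_set_eq, Set.ncard_coe_finset] at h1
  have h2 := h1.trans Finset.card_image_le
  rw [Finset.card_erase_of_mem (Finset.mem_univ r), Finset.card_univ] at h2
  have h3 : 0 < Fintype.card V := Fintype.card_pos_iff.2 ⟨r⟩
  rw [Nat.card_eq_fintype_card (α := V), Nat.card_coe_set_eq]
  omega

/-- Induction on the number of steps to the root: if `f v` is not the `g`-parent of `v`, it is a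
`g`-child of `v`. As `f` and `g` agree at `f v`, this gives `f (f v) = v`, a forbidden 2-cycle. -/
lemma eq_of_parentGraph_eq (hf : IsParent r f) (hg : IsParent r g)
    (h : parentGraph f = parentGraph g) : f = g := by
  have key (k : ℕ) (v : V) (hk : f^[k] v = r) : f v = g v := by
    induction k generalizing v with
    | zero =>
      obtain rfl : v = r := hk
      rw [hf.1, hg.1]
    | succ k ih =>
      by_cases hv : v = r
      · rw [hv, hf.1, hg.1]
      have h1 := ih (f v) hk
      have h2 := hf.adj hv
      rw [h] at h2
      rcases (parentGraph_adj.1 h2).2 with h3 | h3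
      · exact h3.symm
      · exact absurd (h1.trans h3) (hf.apply_apply_ne hv)
  funext v
  obtain ⟨k, hk⟩ := hf.2 v
  exact key k v hk

end IsParent

/-- Send each vertex to a neighbor one step nearer to `r`. The resulting graph is a connected
subgraph of `T`, and a tree is minimal among connected graphs. -/
lemma exists_isParent_of_isTree [Fintype V] {T : SimpleGraph V} (hT : T.IsTree) (r : V) :
    ∃ f, IsParent r f ∧ parentGraph f = T := by
  classical
  have hex (v : V) : ∃ w, (v = r → w = r) ∧ (v ≠ r → T.Adj v w ∧ T.dist w r + 1 = T.dist v r) := by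
    by_cases hv : v = r
    · exact ⟨r, fun _ => rfl, fun h => absurd hv h⟩
    · obtain ⟨p, hp⟩ := hT.1.exists_walk_length_eq_dist v r
      cases p with
      | nil => exact absurd rfl hv
      | @cons _ w _ h q =>
        refine ⟨w, fun h' => absurd h' hv, fun _ => ⟨h, ?_⟩⟩
        rw [SimpleGraph.Walk.length_cons] at hp
        have h1 := SimpleGraph.dist_le q
        have h2 := hT.1.dist_triangle (u := v) (v := w) (w := r)
        rw [SimpleGraph.dist_eq_one_iff_adj.2 h] at h2
        omega
  choose f hf1 hf2 using hex
  have key (k : ℕ) (v : V) (hk : T.dist v r = k) : ∃ k, f^[k] v = r := by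
    induction k generalizing v with
    | zero => exact ⟨0, (hT.1.dist_eq_zero_iff).1 hk⟩
    | succ k ih =>
      by_cases hv : v = r
      · exact ⟨0, hv⟩
      · obtain ⟨l, hl⟩ := ih (f v) (by have := (hf2 v hv).2; omega)
        exact ⟨l + 1, hl⟩
  have hp : IsParent r f := ⟨hf1 r rfl, fun v => key _ v rfl⟩
  refine ⟨f, hp, ?_⟩
  refine ((SimpleGraph.isTree_iff_minimal_connected.1 hT).eq_of_le hp.connected ?_)
  have hadj (u : V) (hu : u ≠ f u) : T.Adj u (f u) :=
    (hf2 u fun h => hu (by rw [h, hp.1])).1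
  intro u v h
  obtain ⟨hne, rfl | rfl⟩ := parentGraph_adj.1 h
  · exact hadj u hne
  · exact (hadj v hne.symm).symm

end ParentFunctions

/-! ### Cayley's formula for rooted forests -/

section Forests

variable {V : Type*} [Fintype V] [DecidableEq V]

open Classical in
/-- The parent functions of the forests on `A ∪ R` in which every tree has exactly one vertex
in `R`, its root. -/
noncomputable def forests (A R : Finset V) : Finset (V → V) :=
  {f | (∀ v ∉ A, f v = v) ∧ ∀ a ∈ A, ∃ k, f^[k] a ∈ R}

lemma mem_forests {A R : Finset V} {f : V → V} :
    f ∈ forests A R ↔ (∀ v ∉ A, f v = v) ∧ ∀ a ∈ A, ∃ k, f^[k] a ∈ R := by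
  simp [forests]

lemma mem_forests_erase {r : V} {f : V → V} :
    f ∈ forests (Finset.univ.erase r) {r} ↔ IsParent r f := by
  rw [mem_forests, IsParent]
  simp only [Finset.mem_erase, Finset.mem_univ, and_true, not_not, forall_eq, Finset.mem_singleton]
  refine and_congr_right fun hr => ⟨fun h v => ?_, fun h v _ => h v⟩
  by_cases hv : v = r
  · exact ⟨0, hv⟩
  · exact h v hv

lemma forests_empty (R : Finset V) : forests ∅ R = {id} := by
  ext f
  simp [mem_forests, funext_iff]

/-- Cutting a forest at its roots. -/
lemma card_forests_filter {A R S : Finset V} (hAR : Disjoint A R) (hS : S ⊆ A) :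
    ((forests A R).filter fun f => A.filter (fun a => f a ∈ R) = S).card =
      R.card ^ S.card * (forests (A \ S) S).card := by
  have hpi : (Fintype.piFinset fun v => if v ∈ S then R else {v}).card = R.card ^ S.card := by
    rw [Fintype.card_piFinset, ← Finset.prod_subset (Finset.subset_univ S)]
    · rw [Finset.prod_congr rfl fun v hv => by rw [if_pos hv], Finset.prod_const]
    · intro v _ hv
      rw [if_neg hv, Finset.card_singleton]
  have hpi_mem (g : V → V) : (g ∈ Fintype.piFinset fun v => if v ∈ S then R else {v}) ↔
      (∀ v ∈ S, g v ∈ R) ∧ ∀ v ∉ S, g v = v := by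
    rw [Fintype.mem_piFinset]
    constructor
    · exact fun h => ⟨fun v hv => by simpa [hv] using h v, fun v hv => by simpa [hv] using h v⟩
    · intro h v
      by_cases hv : v ∈ S <;> simp [hv, h.1, h.2]
  have hR {a : V} (ha : a ∈ A) : a ∉ R := Finset.disjoint_left.1 hAR ha
  rw [← hpi, ← Finset.card_product]
  refine Finset.card_nbij' (fun f => (S.piecewise f id, S.piecewise id f))
    (fun p => S.piecewise p.1 p.2) ?_ ?_ ?_ ?_
  · intro f hf
    obtain ⟨hf, hfS⟩ := Finset.mem_filter.1 hf
    obtain ⟨hf1, hf2⟩ := mem_forests.1 hf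
    have hmem (v : V) : v ∈ S ↔ v ∈ A ∧ f v ∈ R := by rw [← hfS, Finset.mem_filter]
    refine Finset.mem_product.2 ⟨(hpi_mem _).2 ⟨fun v hv => ?_, fun v hv => ?_⟩, mem_forests.2
      ⟨fun v hv => ?_, fun a ha => ?_⟩⟩
    · simpa [hv] using ((hmem v).1 hv).2
    · simp [hv]
    · by_cases hvS : v ∈ S
      · simp [hvS]
      · simpa [hvS] using hf1 v fun h => hv (Finset.mem_sdiff.2 ⟨h, hvS⟩)
    · have key (k : ℕ) (a : V) (ha : a ∈ A \ S) (hk : f^[k] a ∈ R) :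
          ∃ l, (S.piecewise id f)^[l] a ∈ S := by
        induction k generalizing a with
        | zero => exact absurd hk (hR (Finset.mem_sdiff.1 ha).1)
        | succ k ih =>
          obtain ⟨haA, haS⟩ := Finset.mem_sdiff.1 ha
          have hfa : S.piecewise id f a = f a := by simp [haS]
          have hfaA : f a ∈ A := by
            by_contra hfaA
            rw [Function.iterate_succ_apply, Function.iterate_fixed (hf1 _ hfaA)] at hk
            exact haS ((hmem a).2 ⟨haA, hk⟩)
          by_cases hfaS : f a ∈ S
          · exact ⟨1, by simpa [hfa] using hfaS⟩
          · obtain ⟨l, hl⟩ := ih (f a) (Finset.mem_sdiff.2 ⟨hfaA, hfaS⟩) hk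
            exact ⟨l + 1, by rwa [Function.iterate_succ_apply, hfa]⟩
      obtain ⟨k, hk⟩ := hf2 a (Finset.mem_sdiff.1 ha).1
      exact key k a ha hk
  · rintro ⟨g, h⟩ hp
    obtain ⟨hg, hh⟩ := Finset.mem_product.1 hp
    obtain ⟨hg1, hg2⟩ := (hpi_mem g).1 hg
    obtain ⟨hh1, hh2⟩ := mem_forests.1 hh
    have hfix {v : V} (hv : v ∉ A \ S) : h v = v := hh1 v hv
    refine Finset.mem_filter.2 ⟨mem_forests.2 ⟨fun v hv => ?_, fun a ha => ?_⟩, ?_⟩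
    · have hvS : v ∉ S := fun h => hv (hS h)
      simpa [hvS] using hfix fun h => hv (Finset.mem_sdiff.1 h).1
    · have key (k : ℕ) (a : V) (hk : h^[k] a ∈ S) : ∃ l, (S.piecewise g h)^[l] a ∈ R := by
        induction k generalizing a with
        | zero => exact ⟨1, by simpa [show a ∈ S from hk] using hg1 a hk⟩
        | succ k ih =>
          by_cases haS : a ∈ S
          · exact ⟨1, by simpa [haS] using hg1 a haS⟩
          · obtain ⟨l, hl⟩ := ih (h a) hk
            exact ⟨l + 1, by rw [Function.iterate_succ_apply]; simpa [haS] using hl⟩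
      by_cases haS : a ∈ S
      · exact ⟨1, by simpa [haS] using hg1 a haS⟩
      · obtain ⟨k, hk⟩ := hh2 a (Finset.mem_sdiff.2 ⟨ha, haS⟩)
        exact key k a hk
    · ext a
      rw [Finset.mem_filter]
      constructor
      · rintro ⟨haA, haR⟩
        by_contra haS
        have haR' : h a ∈ R := by simpa [haS] using haR
        obtain ⟨k, hk⟩ := hh2 a (Finset.mem_sdiff.2 ⟨haA, haS⟩)
        cases k with
        | zero => exact haS hk
        | succ k =>
          rw [Function.iterate_succ_apply, Function.iterate_fixed
            (hfix fun h' => hR (Finset.mem_sdiff.1 h').1 haR')] at hk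
          exact hR (hS hk) haR'
      · intro haS
        exact ⟨hS haS, by simpa [haS] using hg1 a haS⟩
  · intro f _
    ext v
    by_cases hv : v ∈ S <;> simp [hv]
  · rintro ⟨g, h⟩ hp
    obtain ⟨hg, hh⟩ := Finset.mem_product.1 hp
    obtain ⟨-, hg2⟩ := (hpi_mem g).1 hg
    obtain ⟨hh1, -⟩ := mem_forests.1 hh
    refine Prod.ext (funext fun v => ?_) (funext fun v => ?_)
    · by_cases hv : v ∈ S <;> simp [hv, hg2]
    · by_cases hv : v ∈ S
      · simpa [hv] using (hh1 v fun h => (Finset.mem_sdiff.1 h).2 hv).symm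
      · simp [hv]

/-- Absorbing `j` into the binomial coefficient leaves the binomial theorem with exponent `a`. -/
lemma sum_range_choose_mul_pow (a b : ℕ) :
    ∑ j ∈ Finset.range (a + 2), (a + 1).choose j * (b ^ j * (j * (a + 1) ^ (a + 1 - j))) =
      (a + 1) * (b * (a + 1 + b) ^ a) := by
  rw [Finset.sum_range_succ']
  simp only [zero_mul, mul_zero, add_zero, Nat.add_sub_add_right]
  rw [add_comm (a + 1) b, add_pow, Finset.mul_sum, Finset.mul_sum]
  refine Finset.sum_congr rfl fun j _ => ?_
  have h := Nat.add_one_mul_choose_eq a j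
  calc (a + 1).choose (j + 1) * (b ^ (j + 1) * ((j + 1) * (a + 1) ^ (a - j)))
      = ((a + 1).choose (j + 1) * (j + 1)) * (b ^ (j + 1) * (a + 1) ^ (a - j)) := by ring
    _ = _ := by rw [← h]; push_cast; ring

/-- Cayley's formula for forests with prescribed roots. -/
theorem card_forests {A R : Finset V} (hAR : Disjoint A R) :
    (A.card + R.card) * (forests A R).card = R.card * (A.card + R.card) ^ A.card := by
  induction hn : A.card using Nat.strong_induction_on generalizing A R with
  | _ n ih =>
  subst hn
  rcases A.eq_empty_or_nonempty with rfl | hA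
  · simp [forests_empty]
  obtain ⟨a, ha⟩ : ∃ a, A.card = a + 1 := ⟨A.card - 1, by have := hA.card_pos; omega⟩
  -- `S` is the set of children of the roots. The induction hypothesis applies to nonempty `S`; for
  -- empty `S` no forest exists, and both sides vanish.
  have hrec (S : Finset V) (hS : S ∈ A.powerset) :
      A.card * (forests (A \ S) S).card = S.card * A.card ^ (A.card - S.card) := by
    have hSA := Finset.mem_powerset.1 hS
    have hcard := Finset.card_sdiff_add_card_eq_card hSA
    rcases S.eq_empty_or_nonempty with rfl | hne
    · obtain ⟨x, hx⟩ := hA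
      have : forests (A \ ∅) ∅ = (∅ : Finset (V → V)) := by
        ext f
        simp only [mem_forests, Finset.notMem_empty, exists_false, imp_false, iff_false]
        exact fun h => h.2 x (by simpa using hx)
      rw [this]
      simp
    · have h := ih (A \ S).card (by have := hne.card_pos; omega) Finset.sdiff_disjoint rfl
      rw [hcard] at h
      rw [h, ← hcard, Nat.add_sub_cancel]
  have hsum : A.card * (forests A R).card = A.card * (R.card * (A.card + R.card) ^ a) := by
    have hmaps : ∀ f ∈ forests A R, A.filter (fun a => f a ∈ R) ∈ A.powerset :=
      fun f _ => Finset.mem_powerset.2 (Finset.filter_subset _ _)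
    rw [Finset.card_eq_sum_card_fiberwise hmaps, Finset.mul_sum, Finset.sum_congr rfl fun S hS => by
      rw [card_forests_filter hAR (Finset.mem_powerset.1 hS), mul_left_comm, hrec S hS]]
    rw [Finset.sum_powerset_apply_card fun j => R.card ^ j * (j * A.card ^ (A.card - j)), ha,
      ← sum_range_choose_mul_pow]
    simp
  rw [Nat.eq_of_mul_eq_mul_left hA.card_pos hsum, ha]
  ring

end Forests

/-! ### Pendant copies: grafting, overlaps and counting -/

section Pendant

variable {V I : Type*}

/-- The rooted tree with parent function `p` and root `o` occurs through `φ` as the set of all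
descendants of the vertex `φ o` in the rooted tree (or forest) with parent function `f`. -/
def IsPendant (p : I → I) (o : I) (f : V → V) (φ : I → V) : Prop :=
  (∀ i, i ≠ o → f (φ i) = φ (p i)) ∧ ∀ v, v ∉ Set.range φ ∨ v = φ o → f v ∉ Set.range φ

/-- The parent function obtained from `f` by giving the range of `φ` the structure of a pendant copy
of `p` whose root has parent `u`. -/
noncomputable def graft (p : I → I) (o : I) (u : V) (φ : I → V) (f : V → V) : V → V :=
  open Classical in Function.extend φ (fun i => if i = o then u else φ (p i)) f

section Graft

variable {p : I → I} {o : I} {u r : V} {φ : I → V} {f : V → V} (hφ : Function.Injective φ)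

include hφ

lemma graft_root : graft p o u φ f (φ o) = u := by
  rw [graft, hφ.extend_apply, if_pos rfl]

lemma graft_apply {i : I} (hi : i ≠ o) : graft p o u φ f (φ i) = φ (p i) := by
  rw [graft, hφ.extend_apply, if_neg hi]

omit hφ in
lemma graft_of_notMem {v : V} (hv : v ∉ Set.range φ) : graft p o u φ f v = f v :=
  Function.extend_apply' _ _ _ hv

lemma isPendant_graft (hu : u ∉ Set.range φ) (hf : ∀ v ∉ Set.range φ, f v ∉ Set.range φ) :
    IsPendant p o (graft p o u φ f) φ := by
  classical
  refine ⟨fun i hi => graft_apply hφ hi, fun v hv => ?_⟩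
  by_cases h : v = φ o
  · rwa [h, graft_root hφ]
  · have hv' := hv.resolve_right h
    rw [graft_of_notMem hv']
    exact hf v hv'

/-- Inside the copy the depth `d` decreases until `φ o` is reached, whose parent `u` lies outside;
from there on the orbit is that of `f` and never re-enters the copy. -/
lemma isParent_graft {d : I → ℕ} (hd : ∀ i, i ≠ o → d (p i) < d i) (hu : u ∉ Set.range φ)
    (hf : ∀ v ∉ Set.range φ, f v ∉ Set.range φ) (hr : r ∉ Set.range φ) (hfr : f r = r)
    (hreach : ∀ v ∉ Set.range φ, ∃ k, f^[k] v = r) : IsParent r (graft p o u φ f) := by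
  classical
  have hout (v : V) (hv : v ∉ Set.range φ) : ∃ k, (graft p o u φ f)^[k] v = r := by
    obtain ⟨k, hk⟩ := hreach v hv
    refine ⟨k, ?_⟩
    induction k generalizing v with
    | zero => exact hk
    | succ k ih =>
      rw [Function.iterate_succ_apply, graft_of_notMem hv]
      exact ih (f v) (hf v hv) hk
  have hin (n : ℕ) (i : I) (hi : d i = n) : ∃ k, (graft p o u φ f)^[k] (φ i) = r := by
    induction n using Nat.strong_induction_on generalizing i with
    | _ n ih =>
      by_cases hio : i = o
      · obtain ⟨k, hk⟩ := hout u hu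
        exact ⟨k + 1, by rw [Function.iterate_succ_apply, hio, graft_root hφ, hk]⟩
      · obtain ⟨k, hk⟩ := ih (d (p i)) (hi ▸ hd i hio) (p i) rfl
        exact ⟨k + 1, by rw [Function.iterate_succ_apply, graft_apply hφ hio, hk]⟩
  refine ⟨by rw [graft_of_notMem hr, hfr], fun v => ?_⟩
  by_cases hv : v ∈ Set.range φ
  · obtain ⟨i, rfl⟩ := hv
    exact hin _ i rfl
  · exact hout v hv

end Graft

namespace IsPendant

variable {p : I → I} {o : I} {f : V → V} {φ ψ : I → V}

lemma apply_notMem (h : IsPendant p o f φ) {v : V} (hv : v ∉ Set.range φ) : f v ∉ Set.range φ :=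
  h.2 v (Or.inl hv)

lemma mem_of_iterate_mem (h : IsPendant p o f φ) {v : V} {k : ℕ} (hk : f^[k] v ∈ Set.range φ) :
    v ∈ Set.range φ := by
  induction k generalizing v with
  | zero => exact hk
  | succ k ih => exact not_imp_not.1 h.apply_notMem (ih hk)

lemma exists_iterate_eq_root (h : IsPendant p o f φ) {d : I → ℕ}
    (hd : ∀ i, i ≠ o → d (p i) < d i) (i : I) : ∃ k, f^[k] (φ i) = φ o := by
  induction hn : d i using Nat.strong_induction_on generalizing i with
  | _ n ih =>
    by_cases hi : i = o
    · exact ⟨0, by rw [hi]; rfl⟩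
    · obtain ⟨k, hk⟩ := ih (d (p i)) (hn ▸ hd i hi) (p i) rfl
      exact ⟨k + 1, by rw [Function.iterate_succ_apply, h.1 i hi, hk]⟩

lemma range_subset_of_root_mem (hφ : IsPendant p o f φ) (hψ : IsPendant p o f ψ) {d : I → ℕ}
    (hd : ∀ i, i ≠ o → d (p i) < d i) (h : ψ o ∈ Set.range φ) : Set.range ψ ⊆ Set.range φ := by
  rintro _ ⟨j, rfl⟩
  obtain ⟨k, hk⟩ := hψ.exists_iterate_eq_root hd j
  exact hφ.mem_of_iterate_mem (hk ▸ h)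

/-- From a common vertex, climb in both copies simultaneously until one of them reaches its root. -/
lemma root_mem_or_root_mem (hφ : IsPendant p o f φ) (hψ : IsPendant p o f ψ) {d : I → ℕ}
    (hd : ∀ i, i ≠ o → d (p i) < d i) {i j : I} (hij : φ i = ψ j) :
    φ o ∈ Set.range ψ ∨ ψ o ∈ Set.range φ := by
  induction hn : d i using Nat.strong_induction_on generalizing i j with
  | _ n ih =>
    by_cases hi : i = o
    · exact Or.inl ⟨j, by rw [← hij, hi]⟩
    by_cases hj : j = o
    · exact Or.inr ⟨i, by rw [hij, hj]⟩
    · exact ih (d (p i)) (hn ▸ hd i hi) (by rw [← hφ.1 i hi, ← hψ.1 j hj, hij]) rfl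

/-- Two pendant copies of the same rooted tree are disjoint or have the same vertices. -/
lemma range_subset_of_not_disjoint [Finite I] (hφ : IsPendant p o f φ) (hψ : IsPendant p o f ψ)
    (hφi : Function.Injective φ) (hψi : Function.Injective ψ) {d : I → ℕ}
    (hd : ∀ i, i ≠ o → d (p i) < d i) (h : ¬ Disjoint (Set.range φ) (Set.range ψ)) :
    Set.range ψ ⊆ Set.range φ := by
  obtain ⟨_, ⟨i, rfl⟩, ⟨j, hj⟩⟩ := Set.not_disjoint_iff.1 h
  rcases hφ.root_mem_or_root_mem hψ hd hj.symm with h | h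
  · have hsub := hψ.range_subset_of_root_mem hφ hd h
    refine (Set.eq_of_subset_of_ncard_le hsub ?_ (Set.finite_range ψ)).ge
    rw [Set.ncard_range_of_injective hφi, Set.ncard_range_of_injective hψi]
  · exact hφ.range_subset_of_root_mem hψ hd h

end IsPendant

section Count

variable [Fintype V] [DecidableEq V] [Fintype I] {p : I → I} {o : I} {r : V}

/-- The parent functions of the rooted trees on `V` with root `r`. -/
noncomputable def parentFunctions (r : V) : Finset (V → V) := forests (Finset.univ.erase r) {r}

lemma mem_parentFunctions {f : V → V} : f ∈ parentFunctions r ↔ IsParent r f :=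
  mem_forests_erase

lemma card_parentFunctions (r : V) {n : ℕ} (hn : Fintype.card V = n + 2) :
    (parentFunctions r).card = (n + 2) ^ n := by
  have h := card_forests (A := Finset.univ.erase r) (R := {r}) (by simp)
  rw [Finset.card_erase_of_mem (Finset.mem_univ r), Finset.card_univ, hn, Finset.card_singleton,
    one_mul, show n + 2 - 1 + 1 = n + 2 from rfl, show n + 2 - 1 = n + 1 from rfl, pow_succ,
    mul_comm] at h
  exact Nat.eq_of_mul_eq_mul_right (by omega) h

/-- The number of forests on the complement of a set that avoids the root. -/
lemma card_forests_compl {B : Finset V} (hr : r ∉ B) {n : ℕ}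
    (hn : Bᶜ.card = n) (hn1 : 1 ≤ n) :
    n * (forests (Bᶜ.erase r) {r}).card = n ^ (n - 1) := by
  have h := card_forests (A := Bᶜ.erase r) (R := {r}) (by simp)
  rw [Finset.card_erase_of_mem (by simpa using hr), hn, Finset.card_singleton, one_mul,
    Nat.sub_add_cancel hn1] at h
  exact h

-- Grafting the copy below any of the `n` remaining vertices, in any tree on these vertices, gives
-- distinct trees: the vertex is recovered as the parent of the root of the copy.
open Classical in
lemma le_card_isPendant (φ : I ↪ {v // v ≠ r}) {d : I → ℕ} (hd : ∀ i, i ≠ o → d (p i) < d i)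
    {n : ℕ} (hn : Fintype.card V = n + Fintype.card I) :
    n ^ (n - 1) ≤
      ((parentFunctions r).filter fun f => IsPendant p o f fun i => (φ i : V)).card := by
  set φ' : I → V := fun i => (φ i : V) with hφ'
  have hinj : Function.Injective φ' := Subtype.val_injective.comp φ.injective
  set B : Finset V := Finset.univ.image φ' with hB
  have hmem (v : V) : v ∈ B ↔ v ∈ Set.range φ' := by simp [hB]
  have hr : r ∉ Set.range φ' := by rintro ⟨i, hi⟩; exact (φ i).2 hi
  have hBc : Bᶜ.card = n := by
    rw [Finset.card_compl, hn, hB, Finset.card_image_of_injective _ hinj, Finset.card_univ,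
      Nat.add_sub_cancel]
  have hrB : r ∉ B := fun h => hr ((hmem r).1 h)
  have hn1 : 1 ≤ n := hBc ▸ Finset.card_pos.2 ⟨r, by simpa using hrB⟩
  rw [← card_forests_compl hrB hBc hn1]
  nth_rewrite 1 [← hBc]
  rw [← Finset.card_product]
  refine Finset.card_le_card_of_injOn (fun q => graft p o q.1 φ' q.2) ?_ ?_
  · rintro ⟨u, h⟩ hq
    obtain ⟨hu, hh⟩ := Finset.mem_product.1 hq
    obtain ⟨hh1, hh2⟩ := mem_forests.1 hh
    have hu' : u ∉ Set.range φ' := fun h => (Finset.mem_compl.1 hu) ((hmem u).2 h)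
    have hfr : h r = r := hh1 r (by simp)
    have hreach (v : V) (hv : v ∉ Set.range φ') : ∃ k, h^[k] v = r := by
      by_cases hvr : v = r
      · exact ⟨0, hvr⟩
      · obtain ⟨k, hk⟩ := hh2 v (by simp [hvr, hmem] at hv ⊢; exact hv)
        exact ⟨k, by simpa using hk⟩
    have hstay (v : V) (hv : v ∉ Set.range φ') : h v ∉ Set.range φ' := fun hhv => by
      obtain ⟨k, hk⟩ := hreach v hv
      cases k with
      | zero => exact hr (by rw [show v = r from hk, hfr] at hhv; exact hhv)
      | succ k =>
        rw [Function.iterate_succ_apply, Function.iterate_fixed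
          (hh1 _ (by simp [(hmem _).2 hhv]))] at hk
        exact hr (hk ▸ hhv)
    exact Finset.mem_filter.2 ⟨mem_parentFunctions.2
      (isParent_graft hinj hd hu' hstay hr hfr hreach), isPendant_graft hinj hu' hstay⟩
  · rintro ⟨u, h⟩ hq ⟨u', h'⟩ hq' heq
    obtain ⟨-, hh⟩ := Finset.mem_product.1 hq
    obtain ⟨-, hh'⟩ := Finset.mem_product.1 hq'
    refine Prod.ext ?_ (funext fun v => ?_)
    · simpa [graft_root hinj] using congrFun heq (φ' o)
    · by_cases hv : v ∈ Set.range φ'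
      · have hvA : v ∉ Bᶜ.erase r := by simp [(hmem _).2 hv]
        exact ((mem_forests.1 hh).1 v hvA).trans ((mem_forests.1 hh').1 v hvA).symm
      · simpa [graft_of_notMem hv] using congrFun heq v

-- A tree with two disjoint pendant copies is determined by the parents of their two roots and by
-- the tree left after deleting both: `n` choices for each parent, and Cayley's number of trees on
-- `n` vertices.
open Classical in
lemma card_isPendant_pair_le (φ ψ : I ↪ {v // v ≠ r})
    (hφψ : Disjoint (Set.range fun i => (φ i : V)) (Set.range fun i => (ψ i : V)))
    {n : ℕ} (hn : Fintype.card V = n + 2 * Fintype.card I) :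
    ((parentFunctions r).filter fun f => (IsPendant p o f fun i => (φ i : V)) ∧
      IsPendant p o f fun i => (ψ i : V)).card ≤ n ^ n := by
  set φ' : I → V := fun i => (φ i : V) with hφ'
  set ψ' : I → V := fun i => (ψ i : V) with hψ'
  have hinj : Function.Injective φ' := Subtype.val_injective.comp φ.injective
  have hinj' : Function.Injective ψ' := Subtype.val_injective.comp ψ.injective
  set B : Finset V := Finset.univ.image φ' ∪ Finset.univ.image ψ' with hB
  have hmem (v : V) : v ∈ B ↔ v ∈ Set.range φ' ∨ v ∈ Set.range ψ' := by simp [hB]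
  have hrB : r ∉ B := fun h => by
    rcases (hmem r).1 h with ⟨i, hi⟩ | ⟨i, hi⟩
    exacts [(φ i).2 hi, (ψ i).2 hi]
  have hBc : Bᶜ.card = n := by
    rw [Finset.card_compl, hn, hB, Finset.card_union_of_disjoint,
      Finset.card_image_of_injective _ hinj, Finset.card_image_of_injective _ hinj',
      Finset.card_univ, ← two_mul, Nat.add_sub_cancel]
    rw [← Finset.disjoint_coe]
    simpa using hφψ
  have hn1 : 1 ≤ n := hBc ▸ Finset.card_pos.2 ⟨r, by simpa using hrB⟩
  have hnn : n ^ n = (Bᶜ ×ˢ (Bᶜ ×ˢ forests (Bᶜ.erase r) {r})).card := by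
    rw [Finset.card_product, Finset.card_product, hBc, card_forests_compl hrB hBc hn1, ← pow_succ',
      Nat.sub_add_cancel hn1]
  rw [hnn]
  refine Finset.card_le_card_of_injOn (fun f => (f (φ' o), f (ψ' o), B.piecewise id f)) ?_ ?_
  · intro f hf
    obtain ⟨hf, hfφ, hfψ⟩ := Finset.mem_filter.1 hf
    obtain ⟨hfr, hreach⟩ := mem_parentFunctions.1 hf
    have hstay (v : V) (hv : v ∉ B) : f v ∉ B := by
      rw [hmem, not_or] at hv ⊢
      exact ⟨hfφ.apply_notMem hv.1, hfψ.apply_notMem hv.2⟩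
    refine Finset.mem_product.2 ⟨?_, Finset.mem_product.2 ⟨?_, mem_forests.2 ⟨fun v hv => ?_,
      fun a ha => ?_⟩⟩⟩
    · rw [Finset.mem_compl, hmem, not_or]
      exact ⟨hfφ.2 _ (Or.inr rfl), hfψ.apply_notMem (Set.disjoint_left.1 hφψ ⟨o, rfl⟩)⟩
    · rw [Finset.mem_compl, hmem, not_or]
      exact ⟨hfφ.apply_notMem (Set.disjoint_right.1 hφψ ⟨o, rfl⟩), hfψ.2 _ (Or.inr rfl)⟩
    · by_cases hvB : v ∈ B
      · simp [hvB]
      · have hvr : v = r := by simpa [hvB] using hv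
        simp [hvr, hfr, hrB]
    · have key (k : ℕ) (a : V) (ha : a ∉ B) (hk : f^[k] a = r) : (B.piecewise id f)^[k] a = r := by
        induction k generalizing a with
        | zero => exact hk
        | succ k ih =>
          rw [Function.iterate_succ_apply, Finset.piecewise_eq_of_notMem _ _ _ ha]
          exact ih (f a) (hstay a ha) hk
      obtain ⟨k, hk⟩ := hreach a
      exact ⟨k, Finset.mem_singleton.2
        (key k a (Finset.mem_compl.1 (Finset.mem_of_mem_erase ha)) hk)⟩
  · intro f hf g hg hfg
    obtain ⟨-, hfφ, hfψ⟩ := Finset.mem_filter.1 hf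
    obtain ⟨-, hgφ, hgψ⟩ := Finset.mem_filter.1 hg
    simp only [Prod.mk.injEq] at hfg
    funext v
    by_cases hv : v ∈ B
    · rcases (hmem v).1 hv with ⟨i, rfl⟩ | ⟨i, rfl⟩
      · by_cases hi : i = o
        · rw [hi, hfg.1]
        · rw [hfφ.1 i hi, hgφ.1 i hi]
      · by_cases hi : i = o
        · rw [hi, hfg.2.1]
        · rw [hfψ.1 i hi, hgψ.1 i hi]
    · simpa [hv] using congrFun hfg.2.2 v

end Count

end Pendant

/-! ### The second moment method -/

section SecondMoment

variable {V I : Type*} [Fintype V] [DecidableEq V] [Fintype I] {p : I → I} {o : I} {r : V}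

open Classical in
/-- The placements of pendant copies of `p` in the rooted tree with parent function `f`. -/
noncomputable def placements (p : I → I) (o : I) (r : V) (f : V → V) :
    Finset (I ↪ {v // v ≠ r}) :=
  {φ | IsPendant p o f fun i => (φ i : V)}

lemma mem_placements {f : V → V} {φ : I ↪ {v // v ≠ r}} :
    φ ∈ placements p o r f ↔ IsPendant p o f fun i => (φ i : V) := by
  simp [placements]

lemma le_sum_card_placements {d : I → ℕ} (hd : ∀ i, i ≠ o → d (p i) < d i) {n : ℕ}
    (hn : Fintype.card V = n + Fintype.card I) :
    Fintype.card (I ↪ {v // v ≠ r}) * n ^ (n - 1) ≤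
      ∑ f ∈ parentFunctions r, (placements p o r f).card := by
  classical
  have h : ∑ f ∈ parentFunctions r, (placements p o r f).card =
      ∑ φ : I ↪ {v // v ≠ r},
        ((parentFunctions r).filter fun f => IsPendant p o f fun i => (φ i : V)).card := by
    convert Finset.sum_card_bipartiteAbove_eq_sum_card_bipartiteBelow
      (s := parentFunctions r) (t := (Finset.univ : Finset (I ↪ {v // v ≠ r})))
      (fun f φ => IsPendant p o f fun i => (φ i : V)) using 2
    · simp only [placements, Finset.bipartiteAbove]
    · simp only [Finset.bipartiteBelow]
  rw [h, ← Finset.card_univ, ← smul_eq_mul]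
  exact Finset.card_nsmul_le_sum _ _ _ fun φ _ => le_card_isPendant φ hd hn

-- An overlapping `ψ` has its range inside that of `φ`, so it is `φ` composed with a self-map of
-- `I`.
open Classical in
lemma card_placements_not_disjoint_le {d : I → ℕ} (hd : ∀ i, i ≠ o → d (p i) < d i) (f : V → V)
    {φ : I ↪ {v // v ≠ r}} (hφ : φ ∈ placements p o r f) :
    ((placements p o r f).filter fun ψ => ¬ Disjoint (Set.range fun i => (φ i : V))
      (Set.range fun i => (ψ i : V))).card ≤ Fintype.card I ^ Fintype.card I := by
  have hinj (φ : I ↪ {v // v ≠ r}) : Function.Injective fun i => (φ i : V) :=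
    Subtype.val_injective.comp φ.injective
  rw [← Fintype.card_fun, ← Finset.card_univ]
  refine Finset.card_le_card_of_surjOn
    -- The value `φ` for the other `σ` is arbitrary; only surjectivity onto the overlapping
    -- placements matters.
    (fun σ => if h : ∃ ψ : I ↪ {v // v ≠ r}, ∀ i, ψ i = φ (σ i) then h.choose else φ) ?_
  intro ψ hψ
  obtain ⟨hψ, hdisj⟩ := Finset.mem_filter.1 hψ
  have hsub := (mem_placements.1 hφ).range_subset_of_not_disjoint (mem_placements.1 hψ) (hinj φ)
    (hinj ψ) hd hdisj
  choose σ hσ using fun i => hsub ⟨i, rfl⟩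
  have hex : ∃ ψ : I ↪ {v // v ≠ r}, ∀ i, ψ i = φ (σ i) := ⟨ψ, fun i => Subtype.ext (hσ i).symm⟩
  refine ⟨σ, by simp, ?_⟩
  simp only [dif_pos hex]
  ext i
  rw [hex.choose_spec i]
  exact hσ i

lemma sum_card_placements_sq_le {d : I → ℕ} (hd : ∀ i, i ≠ o → d (p i) < d i) {n : ℕ}
    (hn : Fintype.card V = n + 2 * Fintype.card I) :
    ∑ f ∈ parentFunctions r, (placements p o r f).card ^ 2 ≤
      Fintype.card I ^ Fintype.card I * ∑ f ∈ parentFunctions r, (placements p o r f).card +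
        Fintype.card (I ↪ {v // v ≠ r}) ^ 2 * n ^ n := by
  classical
  set D : (I ↪ {v // v ≠ r}) × (I ↪ {v // v ≠ r}) → Prop := fun q =>
    Disjoint (Set.range fun i => (q.1 i : V)) (Set.range fun i => (q.2 i : V)) with hD
  have hsplit (f : V → V) : (placements p o r f).card ^ 2 ≤
      Fintype.card I ^ Fintype.card I * (placements p o r f).card +
        ((placements p o r f ×ˢ placements p o r f).filter D).card := by
    rw [pow_two, ← Finset.card_product, ← Finset.card_filter_add_card_filter_not (p := D), add_comm]
    refine Nat.add_le_add_right ?_ _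
    rw [Finset.card_filter, Finset.sum_product]
    simp only [← Finset.card_filter]
    rw [mul_comm, ← smul_eq_mul]
    exact Finset.sum_le_card_nsmul _ _ _ fun φ hφ => card_placements_not_disjoint_le hd f hφ
  refine (Finset.sum_le_sum fun f _ => hsplit f).trans ?_
  rw [Finset.sum_add_distrib, ← Finset.mul_sum]
  refine Nat.add_le_add_left ?_ _
  have h : ∑ f ∈ parentFunctions r, ((placements p o r f ×ˢ placements p o r f).filter D).card =
      ∑ q : (I ↪ {v // v ≠ r}) × (I ↪ {v // v ≠ r}), ((parentFunctions r).filter fun f =>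
        ((IsPendant p o f fun i => (q.1 i : V)) ∧ IsPendant p o f fun i => (q.2 i : V)) ∧
          D q).card := by
    convert Finset.sum_card_bipartiteAbove_eq_sum_card_bipartiteBelow
      (s := parentFunctions r)
      (t := (Finset.univ : Finset ((I ↪ {v // v ≠ r}) × (I ↪ {v // v ≠ r}))))
      (fun f q => ((IsPendant p o f fun i => (q.1 i : V)) ∧ IsPendant p o f fun i => (q.2 i : V)) ∧
          D q) using 2
    · congr 1
      ext q
      simp [Finset.bipartiteAbove, mem_placements]
    · simp only [Finset.bipartiteBelow]
  rw [h, pow_two, ← Fintype.card_prod, ← Finset.card_univ, ← smul_eq_mul]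
  refine Finset.sum_le_card_nsmul _ _ _ fun q _ => ?_
  by_cases hq : D q
  · simp only [hq, and_true]
    exact card_isPendant_pair_le q.1 q.2 hq hn
  · simp [hq]

/-- Cauchy–Schwarz, with the sum restricted to the trees having a placement. -/
lemma sq_sum_card_placements_le : (∑ f ∈ parentFunctions r, (placements p o r f).card) ^ 2 ≤
    ((parentFunctions r).filter fun f => (placements p o r f).Nonempty).card *
      ∑ f ∈ parentFunctions r, (placements p o r f).card ^ 2 := by
  have h : ∑ f ∈ parentFunctions r, (placements p o r f).card =
      ∑ f ∈ (parentFunctions r).filter fun f => (placements p o r f).Nonempty,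
        (placements p o r f).card := by
    refine (Finset.sum_filter_of_ne fun f _ hf => ?_).symm
    exact Finset.card_pos.1 (Nat.pos_of_ne_zero hf)
  rw [h]
  refine (sq_sum_le_card_mul_sum_sq).trans (Nat.mul_le_mul_left _ ?_)
  exact Finset.sum_le_sum_of_subset (Finset.filter_subset _ _)

/-- A lower bound for the fraction of rooted trees with `a + 2 * (m + 1)` vertices that contain a
given pendant rooted tree with `m + 1` vertices. -/
noncomputable def fractionBound (m a : ℕ) : ℝ :=
  ((m + 1 : ℝ) ^ (m + 1) * (Real.exp (2 * (m + 1)) / (a + (m + 1))) +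
    ((a + 2 * (m + 1)) / (a + (m + 1)) : ℝ) ^ (2 * m))⁻¹

lemma tendsto_fractionBound (m : ℕ) : Tendsto (fractionBound m) atTop (𝓝 1) := by
  have hx : Tendsto (fun a : ℕ => (a + (m + 1) : ℝ)) atTop atTop :=
    tendsto_atTop_add_const_right _ _ tendsto_natCast_atTop_atTop
  have hq : Tendsto (fun a : ℕ => (a + 2 * (m + 1) : ℝ) / (a + (m + 1) : ℝ)) atTop (𝓝 1) := by
    have h := (hx.const_div_atTop (m + 1 : ℝ)).const_add 1
    rw [add_zero] at h
    refine h.congr fun a => ?_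
    have : (a + (m + 1) : ℝ) ≠ 0 := by positivity
    field_simp
    ring
  have h := (((hx.const_div_atTop (Real.exp (2 * (m + 1)))).const_mul
    ((m + 1 : ℝ) ^ (m + 1))).add (hq.pow (2 * m))).inv₀ (by simp)
  rw [one_pow, mul_zero, zero_add, inv_one] at h
  exact h

lemma pow_div_pow_le (m a : ℕ) :
    (a + 2 * (m + 1) : ℝ) ^ (a + 2 * m) /
      ((a + (m + 1) : ℝ) ^ (m + 1) * (a + (m + 1) : ℝ) ^ (a + m)) ≤
        Real.exp (2 * (m + 1)) / (a + (m + 1)) := by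
  have hx : (0 : ℝ) < a + (m + 1) := by positivity
  have h1 : (a + 2 * (m + 1) : ℝ) / (a + (m + 1)) ≤ Real.exp ((m + 1) / (a + (m + 1))) := by
    refine le_trans (le_of_eq ?_) (Real.add_one_le_exp _)
    field_simp
    ring
  have h2 : ((a + 2 * (m + 1) : ℝ) / (a + (m + 1))) ^ (a + 2 * m) ≤ Real.exp (2 * (m + 1)) := by
    refine (pow_le_pow_left₀ (by positivity) h1 _).trans ?_
    rw [← Real.exp_nat_mul, Real.exp_le_exp, mul_div_assoc', div_le_iff₀ hx]
    push_cast
    nlinarith [Nat.cast_nonneg (α := ℝ) a, Nat.cast_nonneg (α := ℝ) m]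
  calc _ = ((a + 2 * (m + 1) : ℝ) / (a + (m + 1))) ^ (a + 2 * m) / (a + (m + 1)) := by
        rw [div_pow, div_div]
        congr 1
        ring
    _ ≤ _ := by gcongr

/-- With k = m + 1, the growing power has base a(a + 2k)/(a + k)² ≤ 1; only a factor with fixed
exponent remains. -/
lemma pow_mul_pow_div_pow_le (m a : ℕ) :
    (a + 2 * (m + 1) : ℝ) ^ (a + 2 * m) * (a : ℝ) ^ a / ((a + (m + 1) : ℝ) ^ (a + m)) ^ 2 ≤
      ((a + 2 * (m + 1)) / (a + (m + 1)) : ℝ) ^ (2 * m) := by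
  have hx : (0 : ℝ) < a + (m + 1) := by positivity
  have h1 : (a + 2 * (m + 1) : ℝ) * a / (a + (m + 1)) ^ 2 ≤ 1 := by
    rw [div_le_one (by positivity)]
    nlinarith [sq_nonneg (m + 1 : ℝ)]
  calc _ = ((a + 2 * (m + 1) : ℝ) * a / (a + (m + 1)) ^ 2) ^ a *
        ((a + 2 * (m + 1)) / (a + (m + 1)) : ℝ) ^ (2 * m) := by
        rw [div_pow, div_pow, div_mul_div_comm, mul_pow, pow_add, ← pow_mul, ← pow_mul, ← pow_add]
        congr 1 <;> ring
    _ ≤ 1 * ((a + 2 * (m + 1)) / (a + (m + 1)) : ℝ) ^ (2 * m) := by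
        gcongr
        exact pow_le_one₀ (by positivity) h1
    _ = _ := one_mul _

theorem fractionBound_le {d : I → ℕ} (hd : ∀ i, i ≠ o → d (p i) < d i) {m a : ℕ}
    (hm : Fintype.card I = m + 1) (hV : Fintype.card V = a + 2 * (m + 1)) :
    fractionBound m a ≤
      (((parentFunctions r).filter fun f => (placements p o r f).Nonempty).card : ℝ) /
        ((parentFunctions r).card : ℝ) := by
  classical
  have h1 := le_sum_card_placements (p := p) (r := r) hd (n := a + (m + 1)) (by rw [hV, hm]; ring)
  have h2 := sum_card_placements_sq_le (p := p) (r := r) hd (n := a) (by rw [hV, hm])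
  have h3 := sq_sum_card_placements_le (p := p) (o := o) (r := r)
  have h8 := pow_div_pow_le m a
  have h9 := pow_mul_pow_div_pow_le m a
  have hZ := card_parentFunctions r (n := a + 2 * m) (by rw [hV]; ring)
  have hN : (a + (m + 1)) ^ (m + 1) ≤ Fintype.card (I ↪ {v // v ≠ r}) := by
    rw [Fintype.card_embedding_eq, Fintype.card_subtype_compl, Fintype.card_subtype_eq, hV, hm]
    -- Each of the `m + 1` factors in the falling factorial from `a + 2 * (m + 1) - 1` is at least
    -- `a + (m + 1)`.
    convert Nat.pow_sub_le_descFactorial _ _ using 2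
    omega
  rw [hm] at h2
  rw [hZ]
  set N := Fintype.card (I ↪ {v // v ≠ r})
  set E := ∑ f ∈ parentFunctions r, (placements p o r f).card
  set S := ∑ f ∈ parentFunctions r, (placements p o r f).card ^ 2
  set g := ((parentFunctions r).filter fun f => (placements p o r f).Nonempty).card
  rw [show a + (m + 1) - 1 = a + m from rfl] at h1
  have h4 : E ^ 2 ≤ g * ((m + 1) ^ (m + 1) * E + N ^ 2 * a ^ a) :=
    h3.trans (Nat.mul_le_mul_left _ h2)
  have h1' : (N : ℝ) * (a + (m + 1) : ℝ) ^ (a + m) ≤ E := by exact_mod_cast h1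
  have h4' : (E : ℝ) ^ 2 ≤ g * ((m + 1 : ℝ) ^ (m + 1) * E + N ^ 2 * (a : ℝ) ^ a) := by
    exact_mod_cast h4
  have hN' : (a + (m + 1) : ℝ) ^ (m + 1) ≤ N := by exact_mod_cast hN
  push_cast
  rw [fractionBound, show (a + 2 * m + 2 : ℝ) = a + 2 * (m + 1) by ring]
  set c : ℝ := (m + 1 : ℝ) ^ (m + 1)
  set Z : ℝ := (a + 2 * (m + 1) : ℝ) ^ (a + 2 * m)
  set α : ℝ := (a + (m + 1) : ℝ) ^ (a + m)
  set β : ℝ := (a : ℝ) ^ a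
  set M : ℝ := (a + (m + 1) : ℝ) ^ (m + 1)
  have hc : 0 < c := by positivity
  have hZ0 : 0 < Z := by positivity
  have hα : 0 < α := by positivity
  have hβ : 0 < β := by
    rcases Nat.eq_zero_or_pos a with rfl | ha
    · simp [β]
    · positivity
  have hM : 0 < M := by positivity
  have hN0 : (0 : ℝ) < N := hM.trans_le hN'
  have hE : (0 : ℝ) < E := (mul_pos hN0 hα).trans_le h1'
  have h5 : (E : ℝ) ^ 2 / (Z * (c * E + N ^ 2 * β)) ≤ g / Z := by
    rw [div_le_div_iff₀ (by positivity) hZ0]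
    calc (E : ℝ) ^ 2 * Z ≤ (g * (c * E + N ^ 2 * β)) * Z := by gcongr
      _ = _ := by ring
  refine le_trans ?_ h5
  -- In this form the bound is monotone in `E` and `E / N`, so lower bounds for these two suffice.
  rw [show (E : ℝ) ^ 2 / (Z * (c * E + N ^ 2 * β)) = (c * (Z / E) + Z * β / (E / N) ^ 2)⁻¹ by
    field_simp]
  refine inv_anti₀ (by positivity) (le_trans ?_ (add_le_add (mul_le_mul_of_nonneg_left h8 hc.le) h9))
  have h6 : M * α ≤ E := (mul_le_mul_of_nonneg_right hN' hα.le).trans h1'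
  have h7 : α ≤ E / N := by rw [le_div_iff₀ hN0, mul_comm]; exact h1'
  gcongr

end SecondMoment

/-! ### Transport along isomorphisms -/

section Isomorphism

variable {V U : Type*} [Fintype V] [Fintype U]

lemma stronglyWalkEquivalent_iso {G : SimpleGraph V} {H : SimpleGraph U} (e : G ≃g H) (v : V) :
    StronglyWalkEquivalent G v H (e v) := by
  classical
  refine stronglyWalkEquivalent_of_intertwining G H v (e v) 1 one_ne_zero
    (Matrix.of fun u v => if u = e v then 1 else 0) ?_ ?_ ?_ fun a => rfl
  · ext x y
    simp [Matrix.mul_apply, Matrix.one_apply, eq_comm]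
  · ext x y
    obtain ⟨x, rfl⟩ := e.surjective x
    simp only [Matrix.mul_apply, SimpleGraph.adjMatrix_apply, Matrix.of_apply, e.injective.eq_iff,
      mul_ite, mul_one, mul_zero, Finset.sum_ite_eq', Finset.mem_univ, if_true, e.map_adj_iff]
    rw [Finset.sum_eq_single x] <;> simp +contextual [eq_comm]
  · ext x
    obtain ⟨x, rfl⟩ := e.surjective x
    simp [Matrix.mulVec, dotProduct]

end Isomorphism

lemma StronglyWalkEquivalent.symm {V U : Type*} {G : SimpleGraph V} {H : SimpleGraph U} {v : V}
    {u : U} (h : StronglyWalkEquivalent G v H u) : StronglyWalkEquivalent H u G v :=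
  ⟨fun k => (h.1 k).symm, fun k => (h.2 k).symm⟩

lemma StronglyWalkEquivalent.trans {V U X : Type*} {G : SimpleGraph V} {H : SimpleGraph U}
    {K : SimpleGraph X} {v : V} {u : U} {x : X} (h : StronglyWalkEquivalent G v H u)
    (h' : StronglyWalkEquivalent H u K x) : StronglyWalkEquivalent G v K x :=
  ⟨fun k => (h.1 k).trans (h'.1 k), fun k => (h.2 k).trans (h'.2 k)⟩

/-! ### From pendant subtrees to docked graphs -/

section TwoLimbs

variable {V Λ : Type*} [DecidableEq Λ]

/-- The rooted tree whose root has two limbs, with roots `a` and `b` and parent functions `qa` and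
`qb`. -/
def twoLimbs (qa qb : Λ → Λ) (a b : Λ) : Option (Λ ⊕ Λ) → Option (Λ ⊕ Λ)
  | none => none
  | some (.inl i) => if i = a then none else some (.inl (qa i))
  | some (.inr i) => if i = b then none else some (.inr (qb i))

/-- The depths in `twoLimbs`, given those in the two limbs. -/
def twoLimbsDepth (da db : Λ → ℕ) : Option (Λ ⊕ Λ) → ℕ
  | none => 0
  | some (.inl i) => da i + 1
  | some (.inr i) => db i + 1

lemma twoLimbs_depth_lt {qa qb : Λ → Λ} {a b : Λ} {da db : Λ → ℕ}
    (ha : ∀ i, i ≠ a → da (qa i) < da i) (hb : ∀ i, i ≠ b → db (qb i) < db i) :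
    ∀ i, i ≠ none → twoLimbsDepth da db (twoLimbs qa qb a b i) < twoLimbsDepth da db i := by
  rintro (_ | i | i) hi
  · exact absurd rfl hi
  · by_cases h : i = a
    · simp [twoLimbs, twoLimbsDepth, h]
    · simpa [twoLimbs, twoLimbsDepth, h] using ha i h
  · by_cases h : i = b
    · simp [twoLimbs, twoLimbsDepth, h]
    · simpa [twoLimbs, twoLimbsDepth, h] using hb i h

/-- The vertices outside of the two limbs and those of the limbs make up all vertices. -/
noncomputable def limbEquiv {φ : Option (Λ ⊕ Λ) → V} (hφ : Function.Injective φ) :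
    {v // v ∉ Set.range (φ ∘ some)} ⊕ (Λ ⊕ Λ) ≃ V :=
  Equiv.ofBijective (Sum.elim Subtype.val (φ ∘ some)) <| by
    constructor
    · rintro (w | i) (w' | j) h
      · exact congrArg _ (Subtype.ext h)
      · exact absurd ⟨j, h.symm⟩ w.2
      · exact absurd ⟨i, h⟩ w'.2
      · exact congrArg _ (Option.some_injective _ (hφ h))
    · intro v
      by_cases hv : v ∈ Set.range (φ ∘ some)
      · obtain ⟨i, rfl⟩ := hv
        exact ⟨.inr i, rfl⟩
      · exact ⟨.inl ⟨v, hv⟩, rfl⟩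

/-- The vertex that carries the two limbs. -/
def limbCarrier {φ : Option (Λ ⊕ Λ) → V} (hφ : Function.Injective φ) :
    {v // v ∉ Set.range (φ ∘ some)} :=
  ⟨φ none, fun ⟨_, hi⟩ => Option.some_ne_none _ (hφ hi)⟩

/-- A tree with a pendant copy of `twoLimbs` arises by attaching two limbs to a graph. -/
noncomputable def dockIso {L : SimpleGraph Λ} {qa qb : Λ → Λ} {a b : Λ}
    (hLa : ∀ i j, L.Adj i j ↔ i ≠ j ∧ (qa i = j ∨ qa j = i))
    (hLb : ∀ i j, L.Adj i j ↔ i ≠ j ∧ (qb i = j ∨ qb j = i)) (hqa : qa a = a) (hqb : qb b = b)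
    {f : V → V} {φ : Option (Λ ⊕ Λ) → V} (hφ : Function.Injective φ)
    (hf : IsPendant (twoLimbs qa qb a b) none f φ) :
    dock ((parentGraph f).comap Subtype.val) (limbCarrier hφ) L a b ≃g parentGraph f where
  toEquiv := limbEquiv hφ
  map_rel_iff' := by
    have hin (i : Λ) : f (φ (some (.inl i))) =
        if i = a then φ none else φ (some (.inl (qa i))) := by
      rw [hf.1 _ (by simp), twoLimbs]
      split_ifs <;> rfl
    have hin' (i : Λ) : f (φ (some (.inr i))) =
        if i = b then φ none else φ (some (.inr (qb i))) := by
      rw [hf.1 _ (by simp), twoLimbs]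
      split_ifs <;> rfl
    -- The carrier `φ none` counts as outside the limbs, hence the separate case: its parent avoids
    -- the copy because it is the root of the copy.
    have hout (w : {v // v ∉ Set.range (φ ∘ some)}) (i : Λ ⊕ Λ) : f w ≠ φ (some i) := fun h => by
      refine hf.2 w ?_ ⟨_, h.symm⟩
      by_cases hw : (w : V) = φ none
      · exact Or.inr hw
      · refine Or.inl ?_
        rintro ⟨_ | j, hj⟩
        · exact hw hj.symm
        · exact w.2 ⟨j, hj⟩
    have hne (w : {v // v ∉ Set.range (φ ∘ some)}) (i : Λ ⊕ Λ) : φ (some i) ≠ w :=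
      fun h => w.2 ⟨i, h⟩
    have hA (w : {v // v ∉ Set.range (φ ∘ some)}) (i : Λ) :
        (parentGraph f).Adj w (φ (some (.inl i))) ↔ w = limbCarrier hφ ∧ i = a := by
      rw [parentGraph_adj, hin, Subtype.ext_iff]
      by_cases hi : i = a
      · simp only [hi, if_true, hout, false_or, and_true, (hne _ _).symm, ne_eq, not_false_eq_true,
          true_and]
        exact eq_comm
      · simp [hi, hout, hne]
    have hB (w : {v // v ∉ Set.range (φ ∘ some)}) (i : Λ) :
        (parentGraph f).Adj w (φ (some (.inr i))) ↔ w = limbCarrier hφ ∧ i = b := by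
      rw [parentGraph_adj, hin', Subtype.ext_iff]
      by_cases hi : i = b
      · simp only [hi, if_true, hout, false_or, and_true, (hne _ _).symm, ne_eq, not_false_eq_true,
          true_and]
        exact eq_comm
      · simp [hi, hout, hne]
    have hstep (i j : Λ) (hij : i ≠ j) : f (φ (some (.inl i))) = φ (some (.inl j)) ↔ qa i = j := by
      rw [hin]
      by_cases hi : i = a
      · subst hi
        simp [hφ.eq_iff, hqa, hij]
      · simp [hi, hφ.eq_iff]
    have hstep' (i j : Λ) (hij : i ≠ j) : f (φ (some (.inr i))) = φ (some (.inr j)) ↔ qb i = j := by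
      rw [hin']
      by_cases hi : i = b
      · subst hi
        simp [hφ.eq_iff, hqb, hij]
      · simp [hi, hφ.eq_iff]
    have hcross (i j : Λ) : ¬ (parentGraph f).Adj (φ (some (.inl i))) (φ (some (.inr j))) := by
      rw [parentGraph_adj, hin, hin']
      rintro ⟨-, h | h⟩ <;> split_ifs at h <;> simpa using hφ h
    rintro (w | i | i) (w' | j | j)
    · exact Iff.rfl
    · exact hA w j
    · exact hB w j
    · exact ((parentGraph f).adj_comm _ _).trans (hA w' i)
    · change (parentGraph f).Adj (φ (some (.inl i))) (φ (some (.inl j))) ↔ L.Adj i j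
      rw [parentGraph_adj, hLa, hφ.ne_iff]
      simp only [ne_eq, Option.some.injEq, Sum.inl.injEq]
      exact and_congr_right fun hij => or_congr (hstep i j hij) (hstep j i (Ne.symm hij))
    · exact iff_of_false (hcross i j) id
    · exact ((parentGraph f).adj_comm _ _).trans (hB w' i)
    · exact iff_of_false (fun h => hcross j i h.symm) id
    · change (parentGraph f).Adj (φ (some (.inr i))) (φ (some (.inr j))) ↔ L.Adj i j
      rw [parentGraph_adj, hLb, hφ.ne_iff]
      simp only [ne_eq, Option.some.injEq, Sum.inr.injEq]
      exact and_congr_right fun hij => or_congr (hstep' i j hij) (hstep' j i (Ne.symm hij))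

end TwoLimbs

/-! ### Trees containing the two limbs -/

section Consequences

/-- The distances to the vertex `6` in `limb`. -/
def limbDepthSix : Fin 11 → ℕ := ![1, 2, 3, 4, 5, 5, 0, 1, 2, 3, 2]

/-- The distances to the vertex `2` in `limb`. -/
def limbDepthTwo : Fin 11 → ℕ := ![2, 1, 0, 1, 2, 2, 3, 4, 5, 6, 3]

lemma limbDepthSix_lt : ∀ i, i ≠ 6 → limbDepthSix (limbParentSix i) < limbDepthSix i := by
  decide

lemma limbDepthTwo_lt : ∀ i, i ≠ 2 → limbDepthTwo (limbParentTwo i) < limbDepthTwo i := by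
  decide

variable {V : Type*} [Fintype V] {r : V} {f : V → V} {φ : Option (Fin 11 ⊕ Fin 11) → V}

theorem exists_not_similar_stronglyWalkEquivalent (hφ : Function.Injective φ)
    (hf : IsPendant (twoLimbs limbParentSix limbParentTwo 6 2) none f φ) :
    ∃ x y, ¬ Similar (parentGraph f) x y ∧
      StronglyWalkEquivalent (parentGraph f) x (parentGraph f) y := by
  classical
  have e := dockIso limb_adj_iff_limbParentSix limb_adj_iff_limbParentTwo rfl rfl hφ hf
  refine ⟨e (.inr (.inl 6)), e (.inr (.inr 2)), ?_, ?_⟩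
  · rintro ⟨α, hα⟩
    exact not_similar_dock_limb _ _ ⟨(e.trans α).trans e.symm, by simp [hα]⟩
  · exact (stronglyWalkEquivalent_iso e _).symm.trans
      ((stronglyWalkEquivalent_dock_limb_copies _ _).trans (stronglyWalkEquivalent_iso e _))

/-- The other tree is obtained on the same vertex set by regrafting the pendant copy so that both
limbs hang by 2. The equivalent vertices are the carriers of the limbs. -/
theorem exists_tree_stronglyWalkEquivalent (hp : IsParent r f) (hφ : Function.Injective φ)
    (hf : IsPendant (twoLimbs limbParentSix limbParentTwo 6 2) none f φ)
    (hr : r ∉ Set.range φ) :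
    ∃ v, ∃ H : SimpleGraph V, H.IsTree ∧ IsEmpty (parentGraph f ≃g H) ∧
      ∃ u, StronglyWalkEquivalent (parentGraph f) v H u := by
  classical
  set p := twoLimbs limbParentTwo limbParentTwo 2 2
  -- The carrier keeps its old parent, so nothing changes outside the limbs.
  set g := graft p none (f (φ none)) φ f
  have hu : f (φ none) ∉ Set.range φ := hf.2 _ (Or.inr rfl)
  have hstay : ∀ v ∉ Set.range φ, f v ∉ Set.range φ := fun v hv => hf.apply_notMem hv
  have hg : IsPendant p none g φ := isPendant_graft hφ hu hstay
  have hgp : IsParent r g := isParent_graft hφ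
    (twoLimbs_depth_lt limbDepthTwo_lt limbDepthTwo_lt) hu hstay hr hp.1 fun v _ => hp.2 v
  have e := dockIso limb_adj_iff_limbParentSix limb_adj_iff_limbParentTwo rfl rfl hφ hf
  have e' := dockIso limb_adj_iff_limbParentTwo limb_adj_iff_limbParentTwo rfl rfl hφ hg
  have hfg (w : {v // v ∉ Set.range (φ ∘ some)}) : g w = f w := by
    by_cases hw : (w : V) = φ none
    · rw [hw]
      exact graft_root hφ
    · refine graft_of_notMem ?_
      rintro ⟨_ | j, hj⟩
      · exact hw hj.symm
      · exact w.2 ⟨j, hj⟩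
  have hR : (parentGraph g).comap (Subtype.val : {v // v ∉ Set.range (φ ∘ some)} → V) =
      (parentGraph f).comap Subtype.val := by
    ext w w'
    simp only [SimpleGraph.comap_adj, parentGraph_adj, hfg]
  rw [hR] at e'
  refine ⟨e (.inl (limbCarrier hφ)), parentGraph g, hgp.isTree, ⟨fun α => ?_⟩,
    e' (.inl (limbCarrier hφ)), ?_⟩
  · exact (isEmpty_dock_limb_iso _ _).false ((e.trans α).trans e'.symm)
  · exact (stronglyWalkEquivalent_iso e _).symm.trans
      ((stronglyWalkEquivalent_dock_limb _ _).trans (stronglyWalkEquivalent_iso e' _))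

end Consequences

/-! ### Passage to labeled trees and the limit -/

section AlmostEveryTree

variable {V : Type*} [Fintype V] [DecidableEq V]

lemma card_isTree (r : V) :
    Nat.card {T : SimpleGraph V // T.IsTree} = (parentFunctions r).card := by
  rw [← Nat.card_eq_finsetCard]
  refine (Nat.card_eq_of_bijective
    (fun f : parentFunctions r => (⟨parentGraph f.1, (mem_parentFunctions.1 f.2).isTree⟩ :
      {T : SimpleGraph V // T.IsTree})) ⟨fun f g h => ?_, fun T => ?_⟩).symm
  · exact Subtype.ext ((mem_parentFunctions.1 f.2).eq_of_parentGraph_eq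
      (mem_parentFunctions.1 g.2) (congrArg Subtype.val h))
  · obtain ⟨f, hf, hT⟩ := exists_isParent_of_isTree T.2 r
    exact ⟨⟨f, mem_parentFunctions.2 hf⟩, Subtype.ext hT⟩

lemma card_le_card_isTree (r : V) (P : SimpleGraph V → Prop) (F : Finset (V → V))
    (hF : F ⊆ parentFunctions r) (hP : ∀ f ∈ F, P (parentGraph f)) :
    F.card ≤ Nat.card {T : SimpleGraph V // T.IsTree ∧ P T} := by
  rw [← Nat.card_eq_finsetCard]
  refine Nat.card_le_card_of_injective
    (fun f => ⟨parentGraph f.1, (mem_parentFunctions.1 (hF f.2)).isTree, hP _ f.2⟩) fun f g h => ?_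
  exact Subtype.ext ((mem_parentFunctions.1 (hF f.2)).eq_of_parentGraph_eq
    (mem_parentFunctions.1 (hF g.2)) (congrArg Subtype.val h))

/-- Almost every tree contains a given rooted tree as a limb. -/
theorem almostEveryTree_of_isPendant {I : Type*} [Fintype I] {p : I → I} {o : I} {d : I → ℕ}
    (hd : ∀ i, i ≠ o → d (p i) < d i) {P : ∀ n : ℕ, SimpleGraph (Fin n) → Prop}
    (hP : ∀ (n : ℕ) (r : Fin n) (f : Fin n → Fin n) (φ : I → Fin n), IsParent r f →
      Function.Injective φ → r ∉ Set.range φ → IsPendant p o f φ → P n (parentGraph f)) :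
    AlmostEveryTree P := by
  classical
  obtain ⟨m, hm⟩ : ∃ m, Fintype.card I = m + 1 :=
    ⟨Fintype.card I - 1, by have := Fintype.card_pos_iff.2 ⟨o⟩; omega⟩
  refine tendsto_of_tendsto_of_tendsto_of_le_of_le'
    ((tendsto_fractionBound m).comp (tendsto_sub_atTop_nat (2 * (m + 1)))) tendsto_const_nhds
    ?_ (Eventually.of_forall fun n => ?_)
  · filter_upwards [eventually_ge_atTop (2 * (m + 1))] with n hn
    have r : Fin n := ⟨0, by omega⟩
    refine (fractionBound_le (V := Fin n) (r := r) hd hm 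
      (by rw [Fintype.card_fin, Nat.sub_add_cancel hn])).trans ?_
    rw [card_isTree r]
    gcongr
    refine card_le_card_isTree r _ _ (Finset.filter_subset _ _) fun f hf => ?_
    obtain ⟨hf, φ, hφ⟩ := Finset.mem_filter.1 hf
    refine hP n r f (fun i => φ i) (mem_parentFunctions.1 hf)
      (Subtype.val_injective.comp φ.injective) ?_ (mem_placements.1 hφ)
    rintro ⟨i, hi⟩
    exact (φ i).2 hi
  · refine div_le_one_of_le₀ ?_ (Nat.cast_nonneg _)
    exact_mod_cast Nat.card_le_card_of_injective
      (fun T : {T : SimpleGraph (Fin n) // T.IsTree ∧ P n T} => (⟨T.1, T.2.1⟩ : {T // T.IsTree}))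
      fun S T h => Subtype.ext (Subtype.mk.inj h)

end AlmostEveryTree

end TreeWalk

theorem theorem1 :
    TreeWalk.AlmostEveryTree (fun n T => ∃ v : Fin n, TreeWalk.IsAmbivalent T v) ∧
    TreeWalk.AlmostEveryTree (fun n T => ∃ v : Fin n, TreeWalk.IsTreeAmbivalent T v) ∧
    TreeWalk.AlmostEveryTree (fun n T => ∃ x y : Fin n,
      ¬ TreeWalk.Similar T x y ∧ TreeWalk.StronglyWalkEquivalent T x T y) := by
  have hd := TreeWalk.twoLimbs_depth_lt TreeWalk.limbDepthSix_lt TreeWalk.limbDepthTwo_lt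
  refine ⟨TreeWalk.almostEveryTree_of_isPendant hd fun n r f φ hf hφ hr hp => ?_,
    TreeWalk.almostEveryTree_of_isPendant hd fun n r f φ hf hφ hr hp =>
      TreeWalk.exists_tree_stronglyWalkEquivalent hf hφ hp hr,
    TreeWalk.almostEveryTree_of_isPendant hd fun n r f φ hf hφ hr hp =>
      TreeWalk.exists_not_similar_stronglyWalkEquivalent hφ hp⟩
  obtain ⟨v, H, hH, hiso, u, hu⟩ := TreeWalk.exists_tree_stronglyWalkEquivalent hf hφ hp hr
  exact ⟨v, H, hH.1, hiso, u, hu⟩
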